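/- A \emph{pointed dcpo} is a partial order with a least element in which every nonempty directed set has a supremum; $[X\to Y]$ is the set of Scott-continuous maps with the pointwise order, $X\times Y$ the product with the componentwise order, and $X_\bot$ the lifting of $X$ (a new least element is added). A \emph{Scott domain} is a pointed dcpo that is algebraic (every element is the directed supremum of the compact elements below it) and bounded complete (every set with an upper bound has a supremum); it is \emph{countably based} if it has only countably many compact elements. Scott domains form a full subcategory of the category of pointed dcpos and Scott-continuous maps. Let $\mathrm{Label}$ be a denumerable set. For a pointed dcpo $X$ let $FX=X^{\mathrm{Label}}$ with the pointwise order, and $Fg=g\circ(-)$ for $g:X\to Y$. For a store domain $S$, the partiality-and-state monad $\mathrm{GS}_S$ is given by $$\mathrm{GS}_S\,X=[S\to (X\times S)_\bot],$$ with unit $x\mapsto \lambda s.(x,s)$ and with $(c \mathbin{>\!\!>\!\!=} f)(s)=f(x)(s')$ if $c(s)=(x,s')$ and $(c \mathbin{>\!\!>\!\!=} f)(s)=\bot$ if $c(s)=\bot$. Define the mixed-variance bifunctor $G$ by $$G(X,Y)=[FX\to (Y\times FY)_\bot],\qquad G(f,g)(\alpha)=(g\times Fg)_\bot\circ\alpha\circ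 Ff ,$$ for $f:X'\to X$, $g:Y\to Y'$; thus $G(X,X)=\mathrm{GS}_{FX}\,X$. For such $f,g$ write $[f\to G(f,g)]:[X\to G(X,Y)]\to[X'\to G(X',Y')]$ for the map $\alpha\mapsto G(f,g)\circ\alpha\circ f$. \textbf{Theorem.} \begin{enumerate} \item $G$ is locally continuous: $(f,g)\mapsto G(f,g)$ is Scott continuous for the pointwise order on hom-sets. Moreover $G(X,Y)$ is a Scott domain if $X$ and $Y$ are, and $\mathrm{GS}_S\,X$ is a Scott domain if $S$ and $X$ are; both are countably based if the given domains are. \item There are a countably based Scott domain $D$ and an isomorphism $\varphi:[D\to \mathrm{GS}_{S}\,D]=[D\to G(D,D)]\to D$ in the category of Scott domains, where $S=FD=[\mathrm{Label}\to D]$. \item $(D,\varphi)$ is initial among all solutions of this equation: for every Scott domain $E$ with an isomorphism $\psi:[E\to \mathrm{GS}_{FE}\,E]=[E\to G(E,E)]\to E$ there are Scott-continuous maps $e:D\to E$ and $p:E\to D$ that form an embedding-projection pair ($p\circ e=\mathrm{id}_D$, $e\circ p\le \mathrm{id}_E$) and satisfy $$e\circ\varphi=\psi\circ[p\to G(p,e)],\qquad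 p\circ\psi=\varphi\circ[e\to G(e,p)],$$ and $(e,p)$ is the only pair of Scott-continuous maps $D\to E$, $E\to D$ satisfying these two equations. \end{enumerate} -/

import Mathlib

open CategoryTheory Opposite
open scoped CategoryTheory.Prod

universe u

namespace StateDomain

/-! ### Pointed dcpos and Scott domains -/

/-- A pointed dcpo: a partial order with a least element in which every (nonempty) directed set
has a least upper bound. -/
class PointedDcpo (α : Type*) [PartialOrder α] : Prop where
  exists_least : ∃ b : α, ∀ a : α, b ≤ a
  exists_isLUB : ∀ d : Set α, d.Nonempty → DirectedOn (· ≤ ·) d → ∃ a, IsLUB d a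

/-- A Scott domain: a pointed dcpo that is algebraic (every element is the directed supremum of
the compact elements below it) and bounded complete (every set that has an upper bound has a
least one). Countability of the basis is the separate predicate `HasCountableBasis`. -/
structure IsScottDomain (α : Type*) [PartialOrder α] : Prop extends PointedDcpo α where
  directedOn_compacts : ∀ x : α, DirectedOn (· ≤ ·) {k : α | IsCompactElement k ∧ k ≤ x}
  isLUB_compacts : ∀ x : α, IsLUB {k : α | IsCompactElement k ∧ k ≤ x} x
  bounded_complete : ∀ s : Set α, BddAbove s → ∃ a, IsLUB s a

/-- The basis of compact elements is countable. -/
def HasCountableBasis (α : Type*) [PartialOrder α] : Prop :=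
  {k : α | IsCompactElement k}.Countable

/-! ### Scott continuous maps and the function space -/

/-- Scott continuous maps. -/
structure ScottMap (α β : Type*) [PartialOrder α] [PartialOrder β] where
  toFun : α → β
  scottContinuous' : ScottContinuous toFun

section ScottMap

variable {α β γ δ : Type*} [PartialOrder α] [PartialOrder β] [PartialOrder γ] [PartialOrder δ]

instance : FunLike (ScottMap α β) α β where
  coe := ScottMap.toFun
  coe_injective f g h := by cases f; cases g; congr

/-- The pointwise order. -/
instance : PartialOrder (ScottMap α β) :=
  PartialOrder.lift (fun f => (f : α → β)) DFunLike.coe_injective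

theorem ScottMap.ext {f g : ScottMap α β} (h : ∀ x, f x = g x) : f = g := DFunLike.ext _ _ h

theorem ScottMap.le_def {f g : ScottMap α β} : f ≤ g ↔ ∀ x, f x ≤ g x := Iff.rfl

theorem ScottMap.scottContinuous (f : ScottMap α β) : ScottContinuous f := f.scottContinuous'

@[simp] theorem ScottMap.mk_apply (f : α → β) (hf : ScottContinuous f) (x : α) :
    (ScottMap.mk f hf) x = f x := rfl

namespace ScottMap

/-- The identity. -/
def id (α : Type*) [PartialOrder α] : ScottMap α α := ⟨fun x => x, ScottContinuous.id⟩

/-- Composition `g ∘ f`. -/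
def comp (g : ScottMap β γ) (f : ScottMap α β) : ScottMap α γ :=
  ⟨fun x => g (f x), f.scottContinuous.comp g.scottContinuous⟩

/-- Constant maps. -/
def const (α : Type*) [PartialOrder α] (b : β) : ScottMap α β :=
  ⟨fun _ => b, ScottContinuous.const b⟩

/-- Pairing `x ↦ (f x, g x)`. -/
def pair (f : ScottMap α β) (g : ScottMap α γ) : ScottMap α (β × γ) :=
  ⟨fun x => (f x, g x), f.scottContinuous.prodMk g.scottContinuous⟩

@[simp] theorem id_apply (x : α) : ScottMap.id α x = x := rfl
@[simp] theorem comp_apply (g : ScottMap β γ) (f : ScottMap α β) (x : α) :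
    g.comp f x = g (f x) := rfl
@[simp] theorem const_apply (b : β) (x : α) : ScottMap.const α b x = b := rfl
@[simp] theorem pair_apply (f : ScottMap α β) (g : ScottMap α γ) (x : α) :
    f.pair g x = (f x, g x) := rfl

theorem isLUB_of_pointwise {d : Set (ScottMap α β)} {g : ScottMap α β}
    (h : ∀ x, IsLUB ((fun f : ScottMap α β => f x) '' d) (g x)) : IsLUB d g :=
  ⟨fun f hf x => (h x).1 ⟨f, hf, rfl⟩,
    fun b hb x => (h x).2 (by rintro _ ⟨f, hf, rfl⟩; exact hb hf x)⟩

theorem directedOn_eval {d : Set (ScottMap α β)} (hd : DirectedOn (· ≤ ·) d) (x : α) :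
    DirectedOn (· ≤ ·) ((fun f : ScottMap α β => f x) '' d) := by
  rintro _ ⟨f, hf, rfl⟩ _ ⟨g, hg, rfl⟩
  obtain ⟨k, hk, h1, h2⟩ := hd f hf g hg
  exact ⟨_, ⟨k, hk, rfl⟩, h1 x, h2 x⟩

/-- Directed suprema of continuous maps are computed pointwise. -/
theorem exists_isLUB_pointwise [PointedDcpo β] {d : Set (ScottMap α β)} (hne : d.Nonempty)
    (hd : DirectedOn (· ≤ ·) d) :
    ∃ g : ScottMap α β, ∀ x, IsLUB ((fun f : ScottMap α β => f x) '' d) (g x) := by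
  choose h hh using fun x : α =>
    PointedDcpo.exists_isLUB _ (hne.image (fun f : ScottMap α β => f x)) (directedOn_eval hd x)
  have hmono : Monotone h := fun x y hxy => (hh x).2 (by
    rintro _ ⟨f, hf, rfl⟩
    exact (f.scottContinuous.monotone hxy).trans ((hh y).1 ⟨f, hf, rfl⟩))
  refine ⟨⟨h, fun e hne he a ha => ⟨?_, fun b hb => (hh a).2 ?_⟩⟩, hh⟩
  · rintro _ ⟨x, hx, rfl⟩
    exact hmono (ha.1 hx)
  · rintro _ ⟨f, hf, rfl⟩
    refine (f.scottContinuous hne he ha).2 ?_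
    rintro _ ⟨x, hx, rfl⟩
    exact ((hh x).1 ⟨f, hf, rfl⟩).trans (hb ⟨x, hx, rfl⟩)

theorem isLUB_eval [PointedDcpo β] {d : Set (ScottMap α β)} (hne : d.Nonempty)
    (hd : DirectedOn (· ≤ ·) d) {g : ScottMap α β} (hg : IsLUB d g) (x : α) :
    IsLUB ((fun f : ScottMap α β => f x) '' d) (g x) := by
  obtain ⟨g', hg'⟩ := exists_isLUB_pointwise hne hd
  rw [hg.unique (isLUB_of_pointwise hg')]
  exact hg' x

theorem scottContinuous_of_pointwise {F : γ → ScottMap α β}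
    (h : ∀ x, ScottContinuous fun c => F c x) : ScottContinuous F := fun d hne hd a ha =>
  isLUB_of_pointwise fun x => by simpa [Set.image_image] using h x hne hd ha

theorem scottContinuous_eval [PointedDcpo β] :
    ScottContinuous fun p : ScottMap α β × α => p.1 p.2 :=
  ScottContinuous.fromProd (fun f => f.scottContinuous)
    (fun x _ hne hd _ ha => isLUB_eval hne hd ha x)

instance [PointedDcpo β] : PointedDcpo (ScottMap α β) where
  exists_least := by
    obtain ⟨b, hb⟩ := PointedDcpo.exists_least (α := β)
    exact ⟨const α b, fun f x => hb _⟩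
  exists_isLUB d hne hd := by
    obtain ⟨g, hg⟩ := exists_isLUB_pointwise hne hd
    exact ⟨g, isLUB_of_pointwise hg⟩

end ScottMap

/-! ### Products, powers and lifting -/

theorem DirectedOn.image_mono {d : Set α} (hd : DirectedOn (· ≤ ·) d) {f : α → β}
    (hf : Monotone f) : DirectedOn (· ≤ ·) (f '' d) := by
  rintro _ ⟨x, hx, rfl⟩ _ ⟨y, hy, rfl⟩
  obtain ⟨z, hz, h1, h2⟩ := hd x hx y hy
  exact ⟨_, ⟨z, hz, rfl⟩, hf h1, hf h2⟩

instance [PointedDcpo α] [PointedDcpo β] : PointedDcpo (α × β) where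
  exists_least := by
    obtain ⟨a, ha⟩ := PointedDcpo.exists_least (α := α)
    obtain ⟨b, hb⟩ := PointedDcpo.exists_least (α := β)
    exact ⟨(a, b), fun p => ⟨ha _, hb _⟩⟩
  exists_isLUB d hne hd := by
    obtain ⟨a, ha⟩ := PointedDcpo.exists_isLUB _ (hne.image Prod.fst)
      (DirectedOn.image_mono hd monotone_fst)
    obtain ⟨b, hb⟩ := PointedDcpo.exists_isLUB _ (hne.image Prod.snd)
      (DirectedOn.image_mono hd monotone_snd)
    exact ⟨(a, b), isLUB_prod.2 ⟨ha, hb⟩⟩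

instance (L : Type*) [PointedDcpo α] : PointedDcpo (L → α) where
  exists_least := by
    obtain ⟨a, ha⟩ := PointedDcpo.exists_least (α := α)
    exact ⟨fun _ => a, fun f _ => ha _⟩
  exists_isLUB d hne hd := by
    choose h hh using fun l : L => PointedDcpo.exists_isLUB _ (hne.image (Function.eval l))
      (DirectedOn.image_mono hd (Function.monotone_eval l))
    exact ⟨h, isLUB_pi.2 hh⟩

/-- The strict extension of a map `f : α → β` to the lifting `α_⊥ = WithBot α`; `b` is the least
element of `β` in all uses. -/
def strictExt (b : β) (f : α → β) : WithBot α → β :=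
  WithBot.recBotCoe b f

theorem scottContinuous_coe : ScottContinuous ((↑) : α → WithBot α) := fun d hne hd a ha => by
  refine ⟨?_, fun b hb => ?_⟩
  · rintro _ ⟨x, hx, rfl⟩
    exact WithBot.coe_le_coe.2 (ha.1 hx)
  · obtain ⟨x, hx⟩ := hne
    induction b using WithBot.recBotCoe with
    | bot => exact absurd (hb ⟨x, hx, rfl⟩) (by simp)
    | coe b => exact WithBot.coe_le_coe.2 (ha.2 fun y hy => WithBot.coe_le_coe.1 (hb ⟨y, hy, rfl⟩))

/-- A directed subset of `α_⊥` that is not contained in `{⊥}` restricts to a directed subset of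
`α`, with the same supremum. -/
theorem lift_directed {d : Set (WithBot α)} (hd : DirectedOn (· ≤ ·) d)
    (h : ∃ x : α, (x : WithBot α) ∈ d) :
    {x : α | (x : WithBot α) ∈ d}.Nonempty ∧ DirectedOn (· ≤ ·) {x : α | (x : WithBot α) ∈ d} := by
  refine ⟨h, fun x hx y hy => ?_⟩
  obtain ⟨z, hz, h1, h2⟩ := hd _ hx _ hy
  induction z using WithBot.recBotCoe with
  | bot => simp at h1
  | coe z => exact ⟨z, hz, WithBot.coe_le_coe.1 h1, WithBot.coe_le_coe.1 h2⟩

theorem lift_isLUB {d : Set (WithBot α)} (h : ∃ x : α, (x : WithBot α) ∈ d) {a : α} :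
    IsLUB d (a : WithBot α) ↔ IsLUB {x : α | (x : WithBot α) ∈ d} a := by
  have hub : ∀ b : α, (b : WithBot α) ∈ upperBounds d ↔
      b ∈ upperBounds {x : α | (x : WithBot α) ∈ d} := fun b => by
    refine ⟨fun hb x hx => WithBot.coe_le_coe.1 (hb hx), fun hb x hx => ?_⟩
    induction x using WithBot.recBotCoe with
    | bot => exact bot_le
    | coe x => exact WithBot.coe_le_coe.2 (hb hx)
  refine ⟨fun ha => ⟨(hub a).1 ha.1, fun b hb => WithBot.coe_le_coe.1 (ha.2 ((hub b).2 hb))⟩,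
    fun ha => ⟨(hub a).2 ha.1, fun b hb => ?_⟩⟩
  induction b using WithBot.recBotCoe with
  | bot =>
    obtain ⟨x, hx⟩ := h
    exact absurd (hb hx) (by simp)
  | coe b => exact WithBot.coe_le_coe.2 (ha.2 ((hub b).1 hb))

instance [PointedDcpo α] : PointedDcpo (WithBot α) where
  exists_least := ⟨⊥, fun _ => bot_le⟩
  exists_isLUB d hne hd := by
    by_cases h : ∃ x : α, (x : WithBot α) ∈ d
    · obtain ⟨a, ha⟩ := PointedDcpo.exists_isLUB _ (lift_directed hd h).1 (lift_directed hd h).2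
      exact ⟨a, (lift_isLUB h).2 ha⟩
    · refine ⟨⊥, fun x hx => ?_, fun _ _ => bot_le⟩
      induction x using WithBot.recBotCoe with
      | bot => exact le_rfl
      | coe x => exact absurd ⟨x, hx⟩ h

theorem scottContinuous_strictExt {b : β} (hb : ∀ y, b ≤ y) {f : α → β} (hf : ScottContinuous f) :
    ScottContinuous (strictExt b f) := fun d hne hd a ha => by
  by_cases h : ∃ x : α, (x : WithBot α) ∈ d
  · obtain ⟨x₀, hx₀⟩ := h
    induction a using WithBot.recBotCoe with
    | bot => exact absurd (ha.1 hx₀) (by simp)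
    | coe a =>
      obtain ⟨h1, h2⟩ := lift_directed hd ⟨x₀, hx₀⟩
      have := hf h1 h2 ((lift_isLUB ⟨x₀, hx₀⟩).1 ha)
      refine ⟨?_, fun c hc => this.2 ?_⟩
      · rintro _ ⟨x, hx, rfl⟩
        induction x using WithBot.recBotCoe with
        | bot => exact hb _
        | coe x => exact this.1 ⟨x, hx, rfl⟩
      · rintro _ ⟨x, hx, rfl⟩
        exact hc ⟨(x : WithBot α), hx, rfl⟩
  · have hd : d = {⊥} := by
      refine (hne.subset_singleton_iff).1 fun x hx => ?_
      induction x using WithBot.recBotCoe with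
      | bot => rfl
      | coe x => exact absurd ⟨x, hx⟩ h
    subst hd
    rw [ha.unique isLUB_singleton, Set.image_singleton]
    exact isLUB_singleton

/-! ### Actions on maps -/

namespace ScottMap

/-- `f_⊥ : α_⊥ → β_⊥`. -/
def liftMap (f : ScottMap α β) : ScottMap (WithBot α) (WithBot β) :=
  ⟨strictExt ⊥ fun x => (f x : WithBot β),
    scottContinuous_strictExt (fun _ => bot_le) (f.scottContinuous.comp scottContinuous_coe)⟩

/-- `f × g`. -/
def prodMap (f : ScottMap α β) (g : ScottMap γ δ) : ScottMap (α × γ) (β × δ) :=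
  ⟨fun p => (f p.1, g p.2), (ScottContinuous.fst.comp f.scottContinuous).prodMk
    (ScottContinuous.snd.comp g.scottContinuous)⟩

/-- `f^L = f ∘ _ : α^L → β^L`. -/
def powMap (L : Type*) (f : ScottMap α β) : ScottMap (L → α) (L → β) :=
  ⟨fun s l => f (s l), fun _ hne hd _ ha => isLUB_pi.2 fun l => by
    simpa [Set.image_image] using f.scottContinuous (hne.image (Function.eval l))
      (DirectedOn.image_mono hd (Function.monotone_eval l)) (isLUB_pi.1 ha l)⟩

theorem scottContinuous_apply [PointedDcpo β] (x : α) :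
    ScottContinuous fun f : ScottMap α β => f x :=
  fun _ hne hd _ ha => isLUB_eval hne hd ha x

/-- `[f → g] : [α → β] → [γ → δ]`, `h ↦ g ∘ h ∘ f`. -/
def fnMap [PointedDcpo β] (f : ScottMap γ α) (g : ScottMap β δ) :
    ScottMap (ScottMap α β) (ScottMap γ δ) :=
  ⟨fun h => g.comp (h.comp f), scottContinuous_of_pointwise fun x =>
    (scottContinuous_apply (f x)).comp g.scottContinuous⟩

end ScottMap

/-! ### Unit and bind of the partiality and state monad

Here `σ` is the domain of stores and `PState σ α = [σ → (α × σ)_⊥]`. -/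

section PState

variable {σ : Type*} [PartialOrder σ]

/-- The domain `[σ → (α × σ)_⊥]`. -/
abbrev PState (σ α : Type*) [PartialOrder σ] [PartialOrder α] : Type _ :=
  ScottMap σ (WithBot (α × σ))

/-- `unit x = λ s. (x, s)`. -/
def PState.unit (σ α : Type*) [PartialOrder σ] [PartialOrder α] : ScottMap α (PState σ α) :=
  ⟨fun x => ⟨fun s => ((x, s) : α × σ),
      ((ScottContinuous.const x).prodMk ScottContinuous.id).comp scottContinuous_coe⟩,
    ScottMap.scottContinuous_of_pointwise fun s =>
      (ScottContinuous.id.prodMk (ScottContinuous.const s)).comp scottContinuous_coe⟩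

variable [PointedDcpo β] [PointedDcpo σ]

/-- The strict extension `(α × σ)_⊥ → (β × σ)_⊥` of the uncurrying of `f : α → PState σ β`. -/
def PState.ext (f : ScottMap α (PState σ β)) :
    ScottMap (WithBot (α × σ)) (WithBot (β × σ)) :=
  ⟨strictExt ⊥ fun q => f q.1 q.2, scottContinuous_strictExt (fun _ => bot_le)
    (((ScottContinuous.fst.comp f.scottContinuous).prodMk ScottContinuous.snd).comp
      ScottMap.scottContinuous_eval)⟩

theorem PState.scottContinuous_ext :
    ScottContinuous (PState.ext : ScottMap α (PState σ β) → _) :=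
  ScottMap.scottContinuous_of_pointwise fun x => by
    induction x using WithBot.recBotCoe with
    | bot => exact ScottContinuous.const ⊥
    | coe q => exact (ScottMap.scottContinuous_apply q.1).comp (ScottMap.scottContinuous_apply q.2)

/-- `(c >>= f) s` is `f x s'` if `c s = (x, s')`, and `⊥` if `c s = ⊥`. -/
def PState.bind (σ α β : Type*) [PartialOrder σ] [PartialOrder α] [PartialOrder β]
    [PointedDcpo σ] [PointedDcpo α] [PointedDcpo β] :
    ScottMap (PState σ α × ScottMap α (PState σ β)) (PState σ β) :=
  ⟨fun p => (PState.ext p.2).comp p.1, ScottMap.scottContinuous_of_pointwise fun s =>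
    ((ScottContinuous.snd.comp PState.scottContinuous_ext).prodMk
      (ScottContinuous.fst.comp (ScottMap.scottContinuous_apply s))).comp
      ScottMap.scottContinuous_eval⟩

end PState

end ScottMap

/-! ### The category of pointed dcpos and Scott continuous maps

Scott domains form the full subcategory given by the predicate `Dcpo.IsScott`. -/

/-- Bundled pointed dcpos. -/
structure Dcpo : Type (u + 1) where
  carrier : Type u
  [order : PartialOrder carrier]
  [dcpo : PointedDcpo carrier]

namespace Dcpo

attribute [instance] Dcpo.order Dcpo.dcpo

instance : Category Dcpo.{u} where
  Hom X Y := ScottMap X.carrier Y.carrier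
  id X := ScottMap.id X.carrier
  comp f g := ScottMap.comp g f

/-- The pointwise order on hom-sets. -/
instance (X Y : Dcpo.{u}) : PartialOrder (X ⟶ Y) :=
  inferInstanceAs (PartialOrder (ScottMap X.carrier Y.carrier))

/-- The continuous map underlying a morphism. -/
def toMap {X Y : Dcpo.{u}} (f : X ⟶ Y) : ScottMap X.carrier Y.carrier := f

/-- The object is a Scott domain. -/
def IsScott (X : Dcpo.{u}) : Prop := IsScottDomain X.carrier

/-- The object has a countable basis. -/
def CountablyBased (X : Dcpo.{u}) : Prop := HasCountableBasis X.carrier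

/-- The function space `[X → Y]`. -/
def fn (X Y : Dcpo.{u}) : Dcpo.{u} := ⟨ScottMap X.carrier Y.carrier⟩

/-- The cartesian product `X × Y`. -/
def prod (X Y : Dcpo.{u}) : Dcpo.{u} := ⟨X.carrier × Y.carrier⟩

/-- The lifting `X_⊥`, as a functor. -/
def lift : Dcpo.{u} ⥤ Dcpo.{u} where
  obj X := ⟨WithBot X.carrier⟩
  map f := (toMap f).liftMap
  map_id X := ScottMap.ext fun x => by
    induction x using WithBot.recBotCoe <;> rfl
  map_comp f g := ScottMap.ext fun x => by
    induction x using WithBot.recBotCoe <;> rfl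

/-- The functor `F` of stores with locations in `L`: `F X = X^L` and `F g = g ∘ _`. -/
def store (L : Type) : Dcpo.{u} ⥤ Dcpo.{u} where
  obj X := ⟨L → X.carrier⟩
  map g := (toMap g).powMap L
  map_id _ := rfl
  map_comp _ _ := rfl

/-- The functor `Y ↦ Y × F Y`, with `g ↦ g × F g`. -/
def valueStore (L : Type) : Dcpo.{u} ⥤ Dcpo.{u} where
  obj Y := prod Y ((store L).obj Y)
  map g := (toMap g).prodMap (toMap ((store L).map g))
  map_id _ := rfl
  map_comp _ _ := rfl

/-- The function space bifunctor `(X, Y) ↦ [X → Y]`, with `(f, g) ↦ (α ↦ g ∘ α ∘ f)`. -/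
def fnFunctor : Dcpo.{u}ᵒᵖ × Dcpo.{u} ⥤ Dcpo.{u} where
  obj P := fn P.1.unop P.2
  map h := ScottMap.fnMap (toMap h.1.unop) (toMap h.2)
  map_id _ := rfl
  map_comp _ _ := rfl

/-- The bifunctor `G(X, Y) = [F X → (Y × F Y)_⊥]`, whose action on morphisms is
`G(f, g)(α) = (g × F g)_⊥ ∘ α ∘ F f`. -/
def G (L : Type) : Dcpo.{u}ᵒᵖ × Dcpo.{u} ⥤ Dcpo.{u} :=
  (store L).op.prod (valueStore L ⋙ lift) ⋙ fnFunctor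

/-- The right-hand side `(X, Y) ↦ [X → G(X, Y)]` of the domain equation, as a bifunctor: for
`f : X' → X` and `g : Y → Y'` it sends `α : X → G(X, Y)` to `G(f, g) ∘ α ∘ f`. -/
def rhs (L : Type) : Dcpo.{u}ᵒᵖ × Dcpo.{u} ⥤ Dcpo.{u} :=
  (CategoryTheory.Prod.fst _ _).prod' (G L) ⋙ fnFunctor

/-- A mixed-variance bifunctor is locally continuous if its action on morphisms is Scott
continuous for the pointwise order on hom-sets. -/
def LocallyContinuous (H : Dcpo.{u}ᵒᵖ × Dcpo.{u} ⥤ Dcpo.{u}) : Prop :=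
  ∀ X X' Y Y' : Dcpo.{u},
    ScottContinuous fun p : (X' ⟶ X) × (Y ⟶ Y') => H.map (p.1.op ×ₘ p.2)

/-! ### The partiality and state monad -/

/-- Functional computational monads `(T, unit, bind)` over the category of pointed dcpos. -/
structure CompMonad where
  T : Dcpo.{u} → Dcpo.{u}
  unit (X : Dcpo.{u}) : ScottMap X.carrier (T X).carrier
  bind (X Y : Dcpo.{u}) :
    ScottMap ((T X).carrier × ScottMap X.carrier (T Y).carrier) (T Y).carrier
  unit_bind (X Y : Dcpo.{u}) (a : X.carrier) (f : ScottMap X.carrier (T Y).carrier) :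
    bind X Y (unit X a, f) = f a
  bind_unit (X : Dcpo.{u}) (m : (T X).carrier) : bind X X (m, unit X) = m
  bind_assoc (X Y Z : Dcpo.{u}) (m : (T X).carrier) (f : ScottMap X.carrier (T Y).carrier)
    (g : ScottMap Y.carrier (T Z).carrier) :
    bind Y Z (bind X Y (m, f), g) =
      bind X Z (m, (bind Y Z).comp (f.pair (ScottMap.const X.carrier g)))

/-- The partiality and state monad with domain of stores `S`: `T X = [S → (X × S)_⊥]`. -/
def GS (S : Dcpo.{u}) : CompMonad.{u} where
  T X := fn S (lift.obj (prod X S))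
  unit X := PState.unit S.carrier X.carrier
  bind X Y := PState.bind S.carrier X.carrier Y.carrier
  unit_bind _ _ _ _ := rfl
  bind_unit X (m : PState S.carrier X.carrier) := ScottMap.ext fun s => by
    change strictExt _ _ (m s) = m s
    induction m s using WithBot.recBotCoe <;> rfl
  bind_assoc X _ _ (m : PState S.carrier X.carrier) _ _ := ScottMap.ext fun s => by
    change strictExt _ _ (strictExt _ _ (m s)) = strictExt _ _ (m s)
    induction m s using WithBot.recBotCoe <;> rfl

/-! ### Solutions of the domain equation -/

/-- `(e, p)` is an embedding-projection pair: `p ∘ e = id` and `e ∘ p ≤ id`. -/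
def IsEPPair {X Y : Dcpo.{u}} (e : X ⟶ Y) (p : Y ⟶ X) : Prop :=
  e ≫ p = 𝟙 X ∧ p ≫ e ≤ 𝟙 Y

/-- The pair `e : D → E`, `p : E → D` is compatible with the solutions
`φ : [D → G(D, D)] ≅ D` and `ψ : [E → G(E, E)] ≅ E`:
`e ∘ φ = ψ ∘ [p → G(p, e)]` and `p ∘ ψ = φ ∘ [e → G(e, p)]`. -/
def IsSolutionHom (L : Type) {D E : Dcpo.{u}} (φ : (rhs L).obj (op D, D) ≅ D)
    (ψ : (rhs L).obj (op E, E) ≅ E) (e : D ⟶ E) (p : E ⟶ D) : Prop :=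
  φ.hom ≫ e = (rhs L).map (p.op ×ₘ e) ≫ ψ.hom ∧
    ψ.hom ≫ p = (rhs L).map (e.op ×ₘ p) ≫ φ.hom

/-- `(D, φ)` is initial among all solutions in Scott domains: for every solution `(E, ψ)` there is
an embedding-projection pair from `D` to `E` compatible with the solutions, and it is the only
compatible pair of Scott continuous maps at all. -/
def IsInitialSolution (L : Type) (D : Dcpo.{u}) (φ : (rhs L).obj (op D, D) ≅ D) : Prop :=
  ∀ (E : Dcpo.{u}) (ψ : (rhs L).obj (op E, E) ≅ E), E.IsScott →
    ∃ (e : D ⟶ E) (p : E ⟶ D), IsEPPair e p ∧ IsSolutionHom L φ ψ e p ∧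
      ∀ (e' : D ⟶ E) (p' : E ⟶ D), IsSolutionHom L φ ψ e' p' → e' = e ∧ p' = p

end Dcpo

end StateDomain

open StateDomain

/-!
Strategy. All Scott-domain facts come from one criterion: a bounded complete pointed dcpo in which
some set `B` of compact elements generates every element under suprema is a Scott domain
(`IsScottDomain.of_generating`), and it is countably based when `B` is countable, because every
compact element is the supremum of a finite subset of `B` (`IsScottDomain.exists_finset_isLUB`).
For products `B` consists of pairs of compact elements, for powers of the families with at most one
compact entry, for the lifting of the compact elements of the original domain, and for function
spaces of the step functions `a ↘ b`. For a sequential bilimit it is the union of the images of the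
compact elements of the approximating domains.

The domain equation is solved for any locally continuous bifunctor `H` on pointed dcpos that sends
all pairs of morphisms to strict morphisms. Let `D₀` be the one-point domain and
`Dₙ₊₁ = H(Dₙ, Dₙ)`. The connecting maps between any two iterates are given by a single recursion,
`trans (n+1) (m+1) = H(trans m n, trans n m)`, and compose up to `≤`, with equality except along
detours through a smaller iterate (`trans_comp_trans_le`, `trans_comp_trans`). The bilimit `D` is
the dcpo of threads, with embeddings `ιₙ` and projections `πₙ` such that `πₙ ∘ ιₙ = id` and the
maps `ιₙ ∘ πₙ` increase to the identity. By local continuity `φ = ⨆ₙ ιₙ₊₁ ∘ H(ιₙ, πₙ)` and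
`⨆ₙ H(πₙ, ιₙ) ∘ πₙ₊₁` are mutually inverse, and since the iterates of `δ ↦ φ ∘ H(δ, δ) ∘ φ⁻¹` from
the least map dominate `ιₙ ∘ πₙ`, their supremum is the identity: `φ` is a minimal invariant
(`exists_minimalInvariant_bilimit`).

Initiality needs only minimal invariance (`IsMinimalInvariant.exists_unique_pair`). For a fixed
point `ψ` on `E`, iterate `(e, p) ↦ (ψ ∘ H(p, e) ∘ φ⁻¹, φ ∘ H(e, p) ∘ ψ⁻¹)` from the least pair. The
suprema of the two components form an embedding-projection pair, since `pₙ ∘ eₙ` is the `n`-th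
unfolding `δₙ` of the identity of `D` and `eₙ ∘ pₙ ≤ id`. Any compatible pair `(e, p)` satisfies
`e ∘ δₙ = eₙ` and `δₙ ∘ p = pₙ`, where the case `n = 0` uses that `e` is strict; hence it is equal
to that pair of suprema.
-/

namespace StateDomain

/-! ### Scott domains presented by a basis -/

section Basis

variable {α β : Type*} [PartialOrder α] [PartialOrder β]

theorem isCompactElement_of_le {b : α} (hb : ∀ a, b ≤ a) : IsCompactElement b :=
  fun _ _ hne _ _ _ => hne.imp fun _ hx => ⟨hx, hb _⟩

theorem IsScottDomain.le_of_forall_compact (hα : IsScottDomain α) {x y : α}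
    (h : ∀ k, IsCompactElement k → k ≤ x → k ≤ y) : x ≤ y :=
  (hα.isLUB_compacts x).2 fun k hk => h k hk.1 hk.2

theorem IsScottDomain.nonempty_compacts (hα : IsScottDomain α) (x : α) :
    {k : α | IsCompactElement k ∧ k ≤ x}.Nonempty := by
  obtain ⟨b, hb⟩ := hα.exists_least
  exact ⟨b, isCompactElement_of_le hb, hb x⟩

theorem isCompactElement_of_isLUB_pair {a b c : α} (ha : IsCompactElement a)
    (hb : IsCompactElement b) (hc : IsLUB {a, b} c) : IsCompactElement c := by
  intro s u hne hd hu hcu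
  obtain ⟨x, hx, hax⟩ := ha s u hne hd hu ((hc.1 (by simp)).trans hcu)
  obtain ⟨y, hy, hby⟩ := hb s u hne hd hu ((hc.1 (by simp)).trans hcu)
  obtain ⟨z, hz, hxz, hyz⟩ := hd x hx y hy
  refine ⟨z, hz, hc.2 ?_⟩
  rintro _ (rfl | rfl)
  exacts [hax.trans hxz, hby.trans hyz]

/-- A bounded complete pointed dcpo is a Scott domain as soon as some set `B` of compact elements
generates it under suprema; `B` need not be closed under finite joins. -/
theorem IsScottDomain.of_generating [PointedDcpo α]
    (hbc : ∀ s : Set α, BddAbove s → ∃ a, IsLUB s a) {B : Set α}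
    (hB : ∀ b ∈ B, IsCompactElement b) (h : ∀ x y, (∀ b ∈ B, b ≤ x → b ≤ y) → x ≤ y) :
    IsScottDomain α where
  directedOn_compacts x := by
    rintro a ⟨ha, hax⟩ b ⟨hb, hbx⟩
    have hub : x ∈ upperBounds {a, b} := by
      rintro _ (rfl | rfl)
      exacts [hax, hbx]
    obtain ⟨c, hc⟩ := hbc {a, b} ⟨x, hub⟩
    exact ⟨c, ⟨isCompactElement_of_isLUB_pair ha hb hc, hc.2 hub⟩, hc.1 (by simp), hc.1 (by simp)⟩
  isLUB_compacts x :=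
    ⟨fun _ hk => hk.2, fun y hy => h x y fun b hb hbx => hy ⟨hB b hb, hbx⟩⟩
  bounded_complete := hbc

/-- If a set `B` generates a Scott domain under suprema, then every compact element is the
supremum of a finite subset of `B`. -/
theorem IsScottDomain.exists_finset_isLUB (hα : IsScottDomain α) {B : Set α}
    (h : ∀ x y, (∀ b ∈ B, b ≤ x → b ≤ y) → x ≤ y) {k : α} (hk : IsCompactElement k) :
    ∃ t : Finset α, ↑t ⊆ B ∧ IsLUB (t : Set α) k := by
  classical
  -- The suprema of the finite subsets of `B` below `k` form a directed set with supremum `k`.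
  let S : Set α := {a | ∃ t : Finset α, ↑t ⊆ B ∧ k ∈ upperBounds (t : Set α) ∧ IsLUB (t : Set α) a}
  have hne : S.Nonempty := by
    obtain ⟨b, hb⟩ := hα.exists_least
    exact ⟨b, ∅, by simp, by simp, by simpa [IsBot] using hb⟩
  have hd : DirectedOn (· ≤ ·) S := by
    rintro a ⟨s, hsB, hsk, hsa⟩ b ⟨t, htB, htk, htb⟩
    have hub : k ∈ upperBounds ((s ∪ t : Finset α) : Set α) := by
      rw [Finset.coe_union, upperBounds_union]
      exact ⟨hsk, htk⟩
    obtain ⟨c, hc⟩ := hα.bounded_complete _ ⟨k, hub⟩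
    refine ⟨c, ⟨s ∪ t, by simp [hsB, htB], hub, hc⟩, ?_, ?_⟩
    · exact hsa.mono hc (by simp)
    · exact htb.mono hc (by simp)
  have hlub : IsLUB S k := by
    refine ⟨?_, fun y hy => h k y fun b hb hbk => hy ⟨{b}, by simpa, by simpa, by simp⟩⟩
    rintro a ⟨t, -, htk, hta⟩
    exact hta.2 htk
  obtain ⟨a, ⟨t, htB, htk, hta⟩, hka⟩ := hk S k hne hd hlub le_rfl
  exact ⟨t, htB, le_antisymm hka (hta.2 htk) ▸ hta⟩

/-- A Scott domain generated by a countable set is countably based; the generators need not be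
compact. -/
theorem IsScottDomain.hasCountableBasis (hα : IsScottDomain α) {B : Set α} (hB : B.Countable)
    (h : ∀ x y, (∀ b ∈ B, b ≤ x → b ≤ y) → x ≤ y) : HasCountableBasis α := by
  choose! t htB ht using fun k (hk : IsCompactElement (α := α) k) => hα.exists_finset_isLUB h hk
  refine Set.MapsTo.countable_of_injOn (f := fun k => (t k : Set α))
    (t := {s | s.Finite ∧ s ⊆ B}) (fun k hk => ⟨(t k).finite_toSet, htB k hk⟩) ?_
    (Set.countable_ofPred_finite_subset hB)
  intro k hk l hl hkl
  have h1 := ht k hk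
  simp only at hkl
  rw [hkl] at h1
  exact h1.unique (ht l hl)

end Basis

/-! ### Closure properties of Scott domains -/

section Closure

variable {α β : Type*} [PartialOrder α] [PartialOrder β]

theorem IsScottDomain.prod_bounded_complete (hα : IsScottDomain α) (hβ : IsScottDomain β)
    (s : Set (α × β)) (hs : BddAbove s) : ∃ a, IsLUB s a := by
  obtain ⟨a, ha⟩ := hα.bounded_complete _ (monotone_fst.map_bddAbove hs)
  obtain ⟨b, hb⟩ := hβ.bounded_complete _ (monotone_snd.map_bddAbove hs)
  exact ⟨(a, b), isLUB_prod.2 ⟨ha, hb⟩⟩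

theorem IsCompactElement.prodMk {a : α} {b : β} (ha : IsCompactElement a)
    (hb : IsCompactElement b) : IsCompactElement (a, b) := by
  intro s u hne hd hu hle
  obtain ⟨h1, h2⟩ := isLUB_prod.1 hu
  obtain ⟨_, ⟨p, hp, rfl⟩, hap⟩ :=
    ha _ _ (hne.image _) (DirectedOn.image_mono hd monotone_fst) h1 hle.1
  obtain ⟨_, ⟨q, hq, rfl⟩, hbq⟩ :=
    hb _ _ (hne.image _) (DirectedOn.image_mono hd monotone_snd) h2 hle.2
  obtain ⟨r, hr, hpr, hqr⟩ := hd p hp q hq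
  exact ⟨r, hr, hap.trans hpr.1, hbq.trans hqr.2⟩

theorem IsScottDomain.prod_generating (hα : IsScottDomain α) (hβ : IsScottDomain β) (x y : α × β)
    (h : ∀ b ∈ {k : α | IsCompactElement k} ×ˢ {k : β | IsCompactElement k}, b ≤ x → b ≤ y) :
    x ≤ y := by
  obtain ⟨a₀, ha₀⟩ := hα.exists_least
  obtain ⟨b₀, hb₀⟩ := hβ.exists_least
  exact ⟨hα.le_of_forall_compact fun k hk hkx =>
      (h (k, b₀) ⟨hk, isCompactElement_of_le hb₀⟩ ⟨hkx, hb₀ _⟩).1,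
    hβ.le_of_forall_compact fun k hk hkx =>
      (h (a₀, k) ⟨isCompactElement_of_le ha₀, hk⟩ ⟨ha₀ _, hkx⟩).2⟩

theorem IsScottDomain.prod (hα : IsScottDomain α) (hβ : IsScottDomain β) :
    IsScottDomain (α × β) :=
  have := hα.toPointedDcpo
  have := hβ.toPointedDcpo
  .of_generating (hα.prod_bounded_complete hβ) (fun _ hb => IsCompactElement.prodMk hb.1 hb.2)
    (hα.prod_generating hβ)

theorem HasCountableBasis.prod (hα : IsScottDomain α) (hβ : IsScottDomain β)
    (cα : HasCountableBasis α) (cβ : HasCountableBasis β) : HasCountableBasis (α × β) :=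
  (hα.prod hβ).hasCountableBasis (Set.Countable.prod cα cβ) (hα.prod_generating hβ)

/-- The elements of `α^L` with at most one component different from the least element `b`, that
component being compact. -/
def singleSupport (L : Type*) (b : α) : Set (L → α) :=
  open Classical in
  ⋃ l : L, Function.update (fun _ => b) l '' {k | IsCompactElement k}

open Classical in
theorem update_le_iff_of_least {L : Type*} {b : α} (hb : ∀ a, b ≤ a) {l : L} {k : α} {f : L → α} :
    Function.update (fun _ => b) l k ≤ f ↔ k ≤ f l := by
  rw [update_le_iff]
  exact and_iff_left fun _ _ => hb _

theorem isCompactElement_of_mem_singleSupport {L : Type*} {b : α} (hb : ∀ a, b ≤ a) {f : L → α}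
    (hf : f ∈ singleSupport L b) : IsCompactElement f := by
  classical
  obtain ⟨l, k, hk, rfl⟩ := Set.mem_iUnion.1 hf
  intro s u hne hd hu hle
  obtain ⟨_, ⟨g, hg, rfl⟩, hkg⟩ := hk _ _ (hne.image _)
    (DirectedOn.image_mono hd (Function.monotone_eval l)) (isLUB_pi.1 hu l)
    ((update_le_iff_of_least hb).1 hle)
  exact ⟨g, hg, (update_le_iff_of_least hb).2 hkg⟩

theorem IsScottDomain.pi_generating {L : Type*} (hα : IsScottDomain α) {b : α} (hb : ∀ a, b ≤ a)
    (x y : L → α) (h : ∀ f ∈ singleSupport L b, f ≤ x → f ≤ y) : x ≤ y := by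
  classical
  refine fun l => hα.le_of_forall_compact fun k hk hkx => (update_le_iff_of_least hb).1 <|
    h _ (Set.mem_iUnion.2 ⟨l, k, hk, ?_⟩) ((update_le_iff_of_least hb).2 hkx)
  congr!

theorem IsScottDomain.pi (L : Type*) (hα : IsScottDomain α) : IsScottDomain (L → α) := by
  have := hα.toPointedDcpo
  obtain ⟨b, hb⟩ := hα.exists_least
  refine .of_generating (fun s hs => ?_)
    (fun _ => isCompactElement_of_mem_singleSupport hb) (hα.pi_generating hb)
  choose h hh using fun l : L =>
    hα.bounded_complete _ ((Function.monotone_eval l).map_bddAbove hs)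
  exact ⟨h, isLUB_pi.2 hh⟩

theorem HasCountableBasis.pi (L : Type*) [Countable L] (hα : IsScottDomain α)
    (cα : HasCountableBasis α) : HasCountableBasis (L → α) := by
  obtain ⟨b, hb⟩ := hα.exists_least
  exact (hα.pi L).hasCountableBasis (Set.countable_iUnion fun _ => cα.image _)
    (hα.pi_generating hb)

theorem IsCompactElement.withBot_coe {k : α} (hk : IsCompactElement k) :
    IsCompactElement (k : WithBot α) := by
  intro s u hne hd hu hle
  have hs : ∃ x : α, (x : WithBot α) ∈ s := by
    by_contra! hs
    have : u ≤ ⊥ := hu.2 fun x hx => by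
      induction x using WithBot.recBotCoe with
      | bot => exact le_rfl
      | coe x => exact absurd hx (hs x)
    simpa using hle.trans this
  induction u using WithBot.recBotCoe with
  | bot => simp at hle
  | coe u =>
    obtain ⟨h1, h2⟩ := lift_directed hd hs
    obtain ⟨x, hx, hkx⟩ := hk _ _ h1 h2 ((lift_isLUB hs).1 hu) (WithBot.coe_le_coe.1 hle)
    exact ⟨x, hx, WithBot.coe_le_coe.2 hkx⟩

theorem IsScottDomain.withBot_generating (hα : IsScottDomain α) (x y : WithBot α)
    (h : ∀ b ∈ ((↑) : α → WithBot α) '' {k | IsCompactElement k}, b ≤ x → b ≤ y) : x ≤ y := by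
  induction x using WithBot.recBotCoe with
  | bot => exact bot_le
  | coe x =>
    induction y using WithBot.recBotCoe with
    | bot =>
      obtain ⟨k, hk, hkx⟩ := hα.nonempty_compacts x
      simpa using h k ⟨k, hk, rfl⟩ (WithBot.coe_le_coe.2 hkx)
    | coe y =>
      exact WithBot.coe_le_coe.2 <| hα.le_of_forall_compact fun k hk hkx =>
        WithBot.coe_le_coe.1 (h k ⟨k, hk, rfl⟩ (WithBot.coe_le_coe.2 hkx))

theorem IsScottDomain.withBot (hα : IsScottDomain α) : IsScottDomain (WithBot α) := by
  have := hα.toPointedDcpo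
  refine .of_generating (fun s hs => ?_) ?_ hα.withBot_generating
  · by_cases h : ∃ x : α, (x : WithBot α) ∈ s
    · obtain ⟨u, hu⟩ := hs
      obtain ⟨x₀, hx₀⟩ := h
      induction u using WithBot.recBotCoe with
      | bot => exact absurd (hu hx₀) (by simp)
      | coe u =>
        obtain ⟨a, ha⟩ := hα.bounded_complete {x : α | (x : WithBot α) ∈ s}
          ⟨u, fun x hx => WithBot.coe_le_coe.1 (hu hx)⟩
        exact ⟨a, (lift_isLUB ⟨x₀, hx₀⟩).2 ha⟩
    · refine ⟨⊥, fun x hx => ?_, fun _ _ => bot_le⟩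
      induction x using WithBot.recBotCoe with
      | bot => exact le_rfl
      | coe x => exact absurd ⟨x, hx⟩ h
  · rintro _ ⟨k, hk, rfl⟩
    exact hk.withBot_coe

theorem HasCountableBasis.withBot (hα : IsScottDomain α) (cα : HasCountableBasis α) :
    HasCountableBasis (WithBot α) :=
  hα.withBot.hasCountableBasis (Set.Countable.image cα _) hα.withBot_generating

/-! ### The function space of two Scott domains -/

/-- A pointwise supremum of continuous maps is continuous, also if the set of maps is not
directed. -/
theorem ScottMap.scottContinuous_of_isLUB {s : Set (ScottMap α β)} {h : α → β}
    (hh : ∀ x, IsLUB ((fun f : ScottMap α β => f x) '' s) (h x)) : ScottContinuous h := by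
  refine fun d hne hd a ha => ⟨?_, fun b hb => (hh a).2 ?_⟩
  · rintro _ ⟨x, hx, rfl⟩
    refine (hh x).2 ?_
    rintro _ ⟨f, hf, rfl⟩
    exact (f.scottContinuous.monotone (ha.1 hx)).trans ((hh a).1 ⟨f, hf, rfl⟩)
  · rintro _ ⟨f, hf, rfl⟩
    refine (f.scottContinuous hne hd ha).2 ?_
    rintro _ ⟨x, hx, rfl⟩
    exact ((hh x).1 ⟨f, hf, rfl⟩).trans (hb ⟨x, hx, rfl⟩)

open Classical in
/-- The step function `a ↘ b`, with value `b` above the compact element `a` and the least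
element `b₀` elsewhere. -/
noncomputable def ScottMap.step {b₀ : β} (hb₀ : ∀ b, b₀ ≤ b) (a : α) (ha : IsCompactElement a)
    (b : β) : ScottMap α β :=
  ⟨fun x => if a ≤ x then b else b₀, fun d hne hd c hc => by
    by_cases hac : a ≤ c
    · obtain ⟨x, hx, hax⟩ := ha d c hne hd hc hac
      dsimp only
      rw [if_pos hac]
      refine ⟨?_, fun y hy => hy ⟨x, hx, if_pos hax⟩⟩
      rintro _ ⟨y, -, rfl⟩
      dsimp only
      split_ifs
      exacts [le_rfl, hb₀ _]
    · dsimp only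
      rw [if_neg hac]
      refine ⟨?_, fun y _ => hb₀ y⟩
      rintro _ ⟨y, hy, rfl⟩
      exact (if_neg fun h => hac (h.trans (hc.1 hy))).le⟩

theorem ScottMap.step_le_iff {b₀ : β} (hb₀ : ∀ b, b₀ ≤ b) {a : α} (ha : IsCompactElement a)
    {b : β} {f : ScottMap α β} : ScottMap.step hb₀ a ha b ≤ f ↔ b ≤ f a := by
  refine ⟨fun h => (if_pos le_rfl).ge.trans (h a), fun h x => ?_⟩
  classical
  change (if a ≤ x then b else b₀) ≤ f x
  split_ifs with hax
  · exact h.trans (f.scottContinuous.monotone hax)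
  · exact hb₀ _

/-- The step functions between compact elements. -/
def ScottMap.compactSteps (α : Type*) [PartialOrder α] {b₀ : β} (hb₀ : ∀ b, b₀ ≤ b) :
    Set (ScottMap α β) :=
  {f | ∃ a, ∃ ha : IsCompactElement a, ∃ b, IsCompactElement b ∧ ScottMap.step hb₀ a ha b = f}

theorem ScottMap.countable_compactSteps {b₀ : β} (hb₀ : ∀ b, b₀ ≤ b) (cα : HasCountableBasis α)
    (cβ : HasCountableBasis β) : (compactSteps α hb₀).Countable := by
  have : Countable {k : α | IsCompactElement k} := cα.to_subtype
  have : Countable {k : β | IsCompactElement k} := cβ.to_subtype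
  refine (Set.countable_range fun p : {k : α | IsCompactElement k} × {k : β | IsCompactElement k} =>
    ScottMap.step hb₀ p.1.1 p.1.2 p.2.1).mono ?_
  rintro _ ⟨a, ha, b, hb, rfl⟩
  exact ⟨(⟨a, ha⟩, ⟨b, hb⟩), rfl⟩

theorem ScottMap.isCompactElement_of_mem_compactSteps [PointedDcpo β] {b₀ : β}
    (hb₀ : ∀ b, b₀ ≤ b) {f : ScottMap α β} (hf : f ∈ compactSteps α hb₀) : IsCompactElement f := by
  obtain ⟨a, ha, b, hb, rfl⟩ := hf
  intro s u hne hd hu hle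
  obtain ⟨_, ⟨g, hg, rfl⟩, hbg⟩ := hb _ _ (hne.image _) (directedOn_eval hd a)
    (isLUB_eval hne hd hu a) ((step_le_iff hb₀ ha).1 hle)
  exact ⟨g, hg, (step_le_iff hb₀ ha).2 hbg⟩

/-- A continuous map on an algebraic domain is determined by its values at compact elements, and
these values by the compact elements below them. -/
theorem IsScottDomain.scottMap_generating (hα : IsScottDomain α) (hβ : IsScottDomain β) {b₀ : β}
    (hb₀ : ∀ b, b₀ ≤ b) (f g : ScottMap α β)
    (h : ∀ k ∈ ScottMap.compactSteps α hb₀, k ≤ f → k ≤ g) : f ≤ g := by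
  intro x
  refine (f.scottContinuous (hα.nonempty_compacts x) (hα.directedOn_compacts x)
    (hα.isLUB_compacts x)).2 ?_
  rintro _ ⟨a, ⟨ha, hax⟩, rfl⟩
  refine le_trans (hβ.le_of_forall_compact fun b hb hbf => ?_) (g.scottContinuous.monotone hax)
  exact (ScottMap.step_le_iff hb₀ ha).1
    (h _ ⟨a, ha, b, hb, rfl⟩ ((ScottMap.step_le_iff hb₀ ha).2 hbf))

theorem IsScottDomain.scottMap (hα : IsScottDomain α) (hβ : IsScottDomain β) :
    IsScottDomain (ScottMap α β) := by
  have := hβ.toPointedDcpo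
  obtain ⟨b₀, hb₀⟩ := hβ.exists_least
  refine .of_generating (fun s ⟨u, hu⟩ => ?_)
    (fun _ => ScottMap.isCompactElement_of_mem_compactSteps hb₀) (hα.scottMap_generating hβ hb₀)
  choose h hh using fun x : α =>
    hβ.bounded_complete ((fun f : ScottMap α β => f x) '' s) ⟨u x, by
      rintro _ ⟨f, hf, rfl⟩
      exact hu hf x⟩
  exact ⟨⟨h, ScottMap.scottContinuous_of_isLUB hh⟩, ScottMap.isLUB_of_pointwise hh⟩

theorem HasCountableBasis.scottMap (hα : IsScottDomain α) (hβ : IsScottDomain β)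
    (cα : HasCountableBasis α) (cβ : HasCountableBasis β) :
    HasCountableBasis (ScottMap α β) := by
  obtain ⟨b₀, hb₀⟩ := hβ.exists_least
  exact (hα.scottMap hβ).hasCountableBasis (ScottMap.countable_compactSteps hb₀ cα cβ)
    (hα.scottMap_generating hβ hb₀)

end Closure

/-! ### Suprema of increasing sequences -/

section ChainSup

variable {α β γ : Type*} [PartialOrder α] [PartialOrder β] [PartialOrder γ]

/-- `c` is an increasing sequence with supremum `a`. -/
def IsChainSup (c : ℕ → α) (a : α) : Prop := Monotone c ∧ IsLUB (Set.range c) a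

namespace IsChainSup

theorem le {c : ℕ → α} {a : α} (h : IsChainSup c a) (n : ℕ) : c n ≤ a := h.2.1 ⟨n, rfl⟩

theorem le_of_forall {c : ℕ → α} {a b : α} (h : IsChainSup c a) (hb : ∀ n, c n ≤ b) : a ≤ b :=
  h.2.2 (by rintro _ ⟨n, rfl⟩; exact hb n)

theorem unique {c : ℕ → α} {a b : α} (ha : IsChainSup c a) (hb : IsChainSup c b) : a = b :=
  ha.2.unique hb.2

theorem exists_of_monotone [PointedDcpo α] {c : ℕ → α} (hc : Monotone c) :
    ∃ a, IsChainSup c a :=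
  (PointedDcpo.exists_isLUB _ (Set.range_nonempty c) hc.directed_le.directedOn_range).imp
    fun _ ha => ⟨hc, ha⟩

theorem const (a : α) : IsChainSup (fun _ => a) a := ⟨monotone_const, by simp⟩

theorem succ {c : ℕ → α} {a : α} (h : IsChainSup c a) : IsChainSup (fun n => c (n + 1)) a :=
  ⟨fun _ _ hmn => h.1 (Nat.succ_le_succ hmn), by
      rintro _ ⟨n, rfl⟩
      exact h.le (n + 1),
    fun _ hb => h.le_of_forall fun n => (h.1 n.le_succ).trans (hb ⟨n, rfl⟩)⟩

theorem map {c : ℕ → α} {a : α} (h : IsChainSup c a) {f : α → β} (hf : ScottContinuous f) :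
    IsChainSup (fun n => f (c n)) (f a) :=
  ⟨hf.monotone.comp h.1, by
    have := hf (Set.range_nonempty c) h.1.directed_le.directedOn_range h.2
    rwa [← Set.range_comp] at this⟩

theorem prodMk {c : ℕ → α} {d : ℕ → β} {a : α} {b : β} (hc : IsChainSup c a)
    (hd : IsChainSup d b) : IsChainSup (fun n => (c n, d n)) (a, b) :=
  ⟨fun _ _ hmn => ⟨hc.1 hmn, hd.1 hmn⟩, isLUB_prod.2 (by
    rw [← Set.range_comp, ← Set.range_comp]
    exact ⟨hc.2, hd.2⟩)⟩

end IsChainSup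

/-! ### Sequential bilimits of Scott domains -/

/-- If the maps `ι n ∘ π n` increase to the identity, then the images of the compact elements of
the approximating domains generate. -/
theorem generating_of_isChainSup {X : ℕ → Type*} [∀ n, PartialOrder (X n)]
    {ι : ∀ n, ScottMap (X n) α} {π : ∀ n, ScottMap α (X n)} (hπι : ∀ n x, π n (ι n x) = x)
    (hsup : ∀ x, IsChainSup (fun n => ι n (π n x)) x) (hX : ∀ n, IsScottDomain (X n)) (x y : α)
    (h : ∀ b ∈ ⋃ n, ι n '' {k | IsCompactElement k}, b ≤ x → b ≤ y) : x ≤ y :=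
  (hsup x).le_of_forall fun n => by
    refine le_trans ((ι n).scottContinuous.monotone ?_) ((hsup y).le n)
    refine (hX n).le_of_forall_compact fun k hk hkx => ?_
    have := h (ι n k) (Set.mem_iUnion.2 ⟨n, k, hk, rfl⟩)
      (((ι n).scottContinuous.monotone hkx).trans ((hsup x).le n))
    exact (hπι n k).ge.trans ((π n).scottContinuous.monotone this)

/-- A sequential bilimit of Scott domains is a Scott domain. -/
theorem IsScottDomain.of_isChainSup [PointedDcpo α] {X : ℕ → Type*} [∀ n, PartialOrder (X n)]
    {ι : ∀ n, ScottMap (X n) α} {π : ∀ n, ScottMap α (X n)} (hπι : ∀ n x, π n (ι n x) = x)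
    (hsup : ∀ x, IsChainSup (fun n => ι n (π n x)) x) (hX : ∀ n, IsScottDomain (X n)) :
    IsScottDomain α := by
  refine .of_generating (fun s ⟨u, hu⟩ => ?_) ?_ (generating_of_isChainSup hπι hsup hX)
  · -- The suprema of the projections of `s` embed into an increasing sequence.
    choose v hv using fun n => (hX n).bounded_complete (π n '' s)
      ((π n).scottContinuous.monotone.map_bddAbove ⟨u, hu⟩)
    obtain ⟨a, ha⟩ := IsChainSup.exists_of_monotone (c := fun n => ι n (v n)) <| by
      refine monotone_nat_of_le_succ fun n => ?_
      refine le_trans ((ι n).scottContinuous.monotone ((hv n).2 ?_)) ((hsup _).le n)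
      rintro _ ⟨x, hx, rfl⟩
      rw [← hπι n (π n x)]
      exact (π n).scottContinuous.monotone (((hsup x).1 n.le_succ).trans
        ((ι (n + 1)).scottContinuous.monotone ((hv (n + 1)).1 ⟨x, hx, rfl⟩)))
    refine ⟨a, fun x hx => (hsup x).le_of_forall fun n => ?_,
      fun b hb => ha.le_of_forall fun n => ?_⟩
    · exact ((ι n).scottContinuous.monotone ((hv n).1 ⟨x, hx, rfl⟩)).trans (ha.le n)
    · refine le_trans ((ι n).scottContinuous.monotone ((hv n).2 ?_)) ((hsup b).le n)
      rintro _ ⟨x, hx, rfl⟩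
      exact (π n).scottContinuous.monotone (hb hx)
  · intro b hb
    obtain ⟨n, k, hk, rfl⟩ := Set.mem_iUnion.1 hb
    intro s u hne hd hu hle
    obtain ⟨_, ⟨x, hx, rfl⟩, hkx⟩ := hk _ _ (hne.image _)
      (DirectedOn.image_mono hd (π n).scottContinuous.monotone) ((π n).scottContinuous hne hd hu)
      ((hπι n k).ge.trans ((π n).scottContinuous.monotone hle))
    exact ⟨x, hx, ((ι n).scottContinuous.monotone hkx).trans ((hsup x).le n)⟩

theorem HasCountableBasis.of_isChainSup [PointedDcpo α] {X : ℕ → Type*}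
    [∀ n, PartialOrder (X n)] {ι : ∀ n, ScottMap (X n) α} {π : ∀ n, ScottMap α (X n)}
    (hπι : ∀ n x, π n (ι n x) = x) (hsup : ∀ x, IsChainSup (fun n => ι n (π n x)) x)
    (hX : ∀ n, IsScottDomain (X n)) (cX : ∀ n, HasCountableBasis (X n)) : HasCountableBasis α :=
  (IsScottDomain.of_isChainSup hπι hsup hX).hasCountableBasis
    (Set.countable_iUnion fun n => (cX n).image _) (generating_of_isChainSup hπι hsup hX)

end ChainSup

/-! ### Continuity of the operations on maps -/

namespace ScottMap

variable {α β γ δ : Type*} [PartialOrder α] [PartialOrder β] [PartialOrder γ] [PartialOrder δ]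

theorem scottContinuous_comp [PointedDcpo β] [PointedDcpo γ] :
    ScottContinuous fun p : ScottMap β γ × ScottMap α β => p.1.comp p.2 :=
  scottContinuous_of_pointwise fun x =>
    (ScottContinuous.fst.prodMk (ScottContinuous.snd.comp (scottContinuous_apply x))).comp
      scottContinuous_eval

theorem scottContinuous_fnMap [PointedDcpo α] [PointedDcpo β] [PointedDcpo δ] :
    ScottContinuous fun p : ScottMap γ α × ScottMap β δ => fnMap p.1 p.2 :=
  scottContinuous_of_pointwise fun h => scottContinuous_of_pointwise fun x =>
    (ScottContinuous.snd.prodMk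
      ((ScottContinuous.fst.comp (scottContinuous_apply x)).comp h.scottContinuous)).comp
      scottContinuous_eval

theorem scottContinuous_powMap (L : Type*) [PointedDcpo β] :
    ScottContinuous (powMap L : ScottMap α β → ScottMap (L → α) (L → β)) :=
  scottContinuous_of_pointwise fun s d hne hd a ha => isLUB_pi.2 fun l => by
    rw [Set.image_image]
    exact scottContinuous_apply (s l) hne hd ha

theorem scottContinuous_prodMap [PointedDcpo β] [PointedDcpo δ] :
    ScottContinuous fun p : ScottMap α β × ScottMap γ δ => p.1.prodMap p.2 :=
  scottContinuous_of_pointwise fun x =>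
    (ScottContinuous.fst.comp (scottContinuous_apply x.1)).prodMk
      (ScottContinuous.snd.comp (scottContinuous_apply x.2))

theorem scottContinuous_liftMap [PointedDcpo β] :
    ScottContinuous (liftMap : ScottMap α β → ScottMap (WithBot α) (WithBot β)) :=
  scottContinuous_of_pointwise fun x => by
    induction x using WithBot.recBotCoe with
    | bot => exact ScottContinuous.const ⊥
    | coe x => exact (scottContinuous_apply x).comp scottContinuous_coe

end ScottMap

namespace Dcpo

/-! ### Dcpo-enriched structure of the category -/

variable {X Y Z : Dcpo.{u}}

instance (X Y : Dcpo.{u}) : PointedDcpo (X ⟶ Y) :=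
  inferInstanceAs (PointedDcpo (ScottMap X.carrier Y.carrier))

theorem hom_ext {f g : X ⟶ Y} (h : ∀ x, toMap f x = toMap g x) : f = g := ScottMap.ext h

theorem scottContinuous_comp :
    ScottContinuous fun p : (X ⟶ Y) × (Y ⟶ Z) => p.1 ≫ p.2 :=
  (ScottContinuous.snd.prodMk ScottContinuous.fst).comp
    (ScottMap.scottContinuous_comp (α := X.carrier) (β := Y.carrier) (γ := Z.carrier))

theorem comp_mono {f f' : X ⟶ Y} {g g' : Y ⟶ Z} (hf : f ≤ f') (hg : g ≤ g') :
    f ≫ g ≤ f' ≫ g' :=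
  (scottContinuous_comp (X := X) (Y := Y) (Z := Z)).monotone
    (show (f, g) ≤ (f', g') from ⟨hf, hg⟩)

theorem isChainSup_comp {f : ℕ → (X ⟶ Y)} {g : ℕ → (Y ⟶ Z)} {a : X ⟶ Y} {b : Y ⟶ Z}
    (hf : IsChainSup f a) (hg : IsChainSup g b) : IsChainSup (fun n => f n ≫ g n) (a ≫ b) :=
  (hf.prodMk hg).map scottContinuous_comp

/-- The least element. -/
noncomputable def least (X : Dcpo.{u}) : X.carrier := (PointedDcpo.exists_least).choose

theorem least_le (x : X.carrier) : X.least ≤ x := (PointedDcpo.exists_least).choose_spec x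

/-- The least morphism. -/
noncomputable def leastHom (X Y : Dcpo.{u}) : X ⟶ Y := ScottMap.const X.carrier Y.least

theorem leastHom_le (f : X ⟶ Y) : leastHom X Y ≤ f := fun _ => least_le _

/-- A morphism is strict if it preserves the least element. -/
def IsStrict (f : X ⟶ Y) : Prop := toMap f X.least = Y.least

theorem IsStrict.leastHom_comp {f : Y ⟶ Z} (hf : IsStrict f) :
    leastHom X Y ≫ f = leastHom X Z := hom_ext fun _ => hf

theorem isStrict_leastHom : IsStrict (leastHom X Y) := rfl

theorem IsStrict.comp {f : X ⟶ Y} {g : Y ⟶ Z} (hf : IsStrict f) (hg : IsStrict g) :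
    IsStrict (f ≫ g) := (congrArg (toMap g) hf).trans hg

theorem isStrict_of_iso_hom (e : X ≅ Y) : IsStrict e.hom := by
  refine le_antisymm ?_ (least_le _)
  have h := (toMap e.hom).scottContinuous.monotone (least_le (toMap e.inv Y.least))
  exact h.trans_eq (congrArg (fun f => toMap f Y.least) e.inv_hom_id)

/-! ### Approximating a fixed point of a bifunctor -/

variable (H : Dcpo.{u}ᵒᵖ × Dcpo.{u} ⥤ Dcpo.{u})

/-- The action of a mixed-variance bifunctor on a pair of morphisms. -/
abbrev act {X X' Y Y' : Dcpo.{u}} (f : X' ⟶ X) (g : Y ⟶ Y') :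
    H.obj (op X, Y) ⟶ H.obj (op X', Y') := H.map (f.op ×ₘ g)

theorem act_comp {X X' X'' Y Y' Y'' : Dcpo.{u}} (f : X' ⟶ X) (f' : X'' ⟶ X') (g : Y ⟶ Y')
    (g' : Y' ⟶ Y'') : act H f g ≫ act H f' g' = act H (f' ≫ f) (g ≫ g') :=
  (H.map_comp _ _).symm

theorem act_id (X Y : Dcpo.{u}) : act H (𝟙 X) (𝟙 Y) = 𝟙 _ := H.map_id (op X, Y)

/-- The bifunctor sends all pairs of morphisms to strict morphisms. -/
def StrictOnHoms : Prop :=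
  ∀ (X X' Y Y' : Dcpo.{u}) (f : X' ⟶ X) (g : Y ⟶ Y'), IsStrict (act H f g)

variable {H}

theorem LocallyContinuous.act_mono (hH : LocallyContinuous H) {X X' Y Y' : Dcpo.{u}}
    {f f' : X' ⟶ X} {g g' : Y ⟶ Y'} (hf : f ≤ f') (hg : g ≤ g') : act H f g ≤ act H f' g' :=
  (hH X X' Y Y').monotone (show (f, g) ≤ (f', g') from ⟨hf, hg⟩)

theorem LocallyContinuous.isChainSup_act (hH : LocallyContinuous H) {X X' Y Y' : Dcpo.{u}}
    {f : ℕ → (X' ⟶ X)} {g : ℕ → (Y ⟶ Y')} {a : X' ⟶ X} {b : Y ⟶ Y'} (hf : IsChainSup f a)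
    (hg : IsChainSup g b) : IsChainSup (fun n => act H (f n) (g n)) (act H a b) :=
  (hf.prodMk hg).map (hH X X' Y Y')

variable (H)

/-- The iterates `Dₙ₊₁ = H(Dₙ, Dₙ)` of the bifunctor, starting from the one-point domain. -/
def approx : ℕ → Dcpo.{u}
  | 0 =>
    { carrier := PUnit
      dcpo := ⟨⟨⟨⟩, fun _ => le_rfl⟩, fun _ _ _ => ⟨⟨⟩, fun _ _ => le_rfl, fun _ _ => le_rfl⟩⟩ }
  | n + 1 => H.obj (op (approx n), approx n)

/-- The connecting morphisms `Dₙ ⟶ Dₘ` and `Dₘ ⟶ Dₙ` between the iterates, defined for all `n`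
and `m` at once. For `n ≤ m` the first is the embedding and the second the projection. Both are
needed in the recursion because the contravariant argument exchanges their roles. -/
noncomputable def transPair :
    ∀ n m : ℕ, (approx H n ⟶ approx H m) × (approx H m ⟶ approx H n)
  | 0, _ => (leastHom _ _, leastHom _ _)
  | _ + 1, 0 => (leastHom _ _, leastHom _ _)
  | n + 1, m + 1 =>
    (act H (transPair n m).2 (transPair n m).1, act H (transPair n m).1 (transPair n m).2)

/-- The connecting morphism `Dₙ ⟶ Dₘ`. -/
noncomputable def trans (n m : ℕ) : approx H n ⟶ approx H m := (transPair H n m).1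

theorem transPair_swap (n m : ℕ) : transPair H m n = (transPair H n m).swap := by
  induction n generalizing m with
  | zero => cases m <;> rfl
  | succ n ih =>
    cases m with
    | zero => rfl
    | succ m =>
      change (act H (transPair H m n).2 (transPair H m n).1, _) = _
      rw [ih m]
      rfl

theorem trans_succ_succ (n m : ℕ) :
    trans H (n + 1) (m + 1) = act H (trans H m n) (trans H n m) := by
  rw [trans, trans, trans, transPair_swap H n m]
  rfl

theorem trans_self (n : ℕ) : trans H n n = 𝟙 _ := by
  induction n with
  | zero => rfl
  | succ n ih => rw [trans_succ_succ, ih, act_id]; rfl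

variable {H}

theorem isStrict_trans (hs : StrictOnHoms H) (n m : ℕ) : IsStrict (trans H n m) := by
  cases n with
  | zero => exact isStrict_leastHom
  | succ n =>
    cases m with
    | zero => exact isStrict_leastHom
    | succ m =>
      rw [trans_succ_succ]
      exact hs _ _ _ _ _ _

theorem hom_approx_zero_subsingleton (f g : X ⟶ approx H 0) : f = g :=
  hom_ext fun _ => Subsingleton.elim (α := PUnit) _ _

/-- The contravariant argument exchanges the outer indices, so the induction is on the middle
index, for all outer indices at once. -/
theorem trans_comp_trans_le (hH : LocallyContinuous H) (hs : StrictOnHoms H) (n m k : ℕ) :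
    trans H n m ≫ trans H m k ≤ trans H n k := by
  induction m generalizing n k with
  | zero => exact leastHom_le _
  | succ m ih =>
    cases n with
    | zero => exact (isStrict_trans hs _ _).leastHom_comp.le
    | succ n =>
      cases k with
      | zero => exact (hom_approx_zero_subsingleton _ _).le
      | succ k =>
        rw [trans_succ_succ, trans_succ_succ, trans_succ_succ]
        exact (act_comp H _ _ _ _).trans_le (hH.act_mono (ih k n) (ih n k))

/-- The connecting morphisms compose, except along detours through a smaller iterate. -/
theorem trans_comp_trans (hs : StrictOnHoms H) {n m k : ℕ} (h : n ≤ m ∨ k ≤ m) :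
    trans H n m ≫ trans H m k = trans H n k := by
  induction m generalizing n k with
  | zero =>
    rcases h with h | h
    · obtain rfl := Nat.le_zero.1 h
      rfl
    · obtain rfl := Nat.le_zero.1 h
      exact hom_approx_zero_subsingleton _ _
  | succ m ih =>
    cases n with
    | zero => exact (isStrict_trans hs _ _).leastHom_comp
    | succ n =>
      cases k with
      | zero => exact hom_approx_zero_subsingleton _ _
      | succ k =>
        rw [trans_succ_succ, trans_succ_succ, trans_succ_succ]
        exact (act_comp H _ _ _ _).trans
          (congrArg₂ (act H) (ih (by lia)) (ih (by lia)))

/-! ### The bilimit -/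

variable (H)

/-- The threads: sequences of elements of the iterates compatible with the projections. -/
def Thread : Type u :=
  {x : ∀ n, (approx H n).carrier // ∀ n m, m ≤ n → toMap (trans H n m) (x n) = x m}

instance : PartialOrder (Thread H) := inferInstanceAs (PartialOrder (Subtype _))

variable {H}

theorem Thread.isLUB_of_coord {s : Set (Thread H)} {a : Thread H}
    (h : ∀ n, IsLUB ((fun x : Thread H => x.1 n) '' s) (a.1 n)) : IsLUB s a :=
  ⟨fun x hx n => (h n).1 ⟨x, hx, rfl⟩,
    fun b hb n => (h n).2 (by rintro _ ⟨x, hx, rfl⟩; exact hb hx n)⟩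

theorem Thread.exists_isLUB_coord {s : Set (Thread H)} (hne : s.Nonempty)
    (hd : DirectedOn (· ≤ ·) s) :
    ∃ a : Thread H, ∀ n, IsLUB ((fun x : Thread H => x.1 n) '' s) (a.1 n) := by
  have hmono : ∀ n, Monotone fun x : Thread H => x.1 n := fun n x y hxy => hxy n
  choose a ha using fun n => PointedDcpo.exists_isLUB _ (hne.image fun x : Thread H => x.1 n)
    (DirectedOn.image_mono hd (hmono n))
  refine ⟨⟨a, fun n m hmn => ?_⟩, ha⟩
  have h := (toMap (trans H n m)).scottContinuous (hne.image fun x : Thread H => x.1 n)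
    (DirectedOn.image_mono hd (hmono n)) (ha n)
  rw [Set.image_image] at h
  refine h.unique ?_
  rw [Set.image_congr fun x _ => x.2 n m hmn]
  exact ha m

theorem Thread.isLUB_coord {s : Set (Thread H)} (hne : s.Nonempty) (hd : DirectedOn (· ≤ ·) s)
    {a : Thread H} (ha : IsLUB s a) (n : ℕ) :
    IsLUB ((fun x : Thread H => x.1 n) '' s) (a.1 n) := by
  obtain ⟨b, hb⟩ := Thread.exists_isLUB_coord hne hd
  rw [ha.unique (Thread.isLUB_of_coord hb)]
  exact hb n

theorem Thread.pointedDcpo (hs : StrictOnHoms H) : PointedDcpo (Thread H) where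
  exists_least := ⟨⟨fun n => (approx H n).least, fun n m _ => isStrict_trans hs n m⟩,
    fun _ _ => least_le _⟩
  exists_isLUB _ hne hd :=
    (Thread.exists_isLUB_coord hne hd).imp fun _ => Thread.isLUB_of_coord

/-- The bilimit of the iterates. -/
def bilimit (hs : StrictOnHoms H) : Dcpo.{u} where
  carrier := Thread H
  dcpo := Thread.pointedDcpo hs

/-- The projection `D ⟶ Dₙ`. -/
def proj (hs : StrictOnHoms H) (n : ℕ) : bilimit hs ⟶ approx H n :=
  show ScottMap (Thread H) _ from
    ⟨fun x => x.1 n, fun _ hne hd _ ha => Thread.isLUB_coord hne hd ha n⟩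

/-- The embedding `Dₙ ⟶ D`. -/
noncomputable def incl (hs : StrictOnHoms H) (n : ℕ) : approx H n ⟶ bilimit hs :=
  show ScottMap _ (Thread H) from
    ⟨fun x => ⟨fun m => toMap (trans H n m) x, fun m k hkm =>
        congrArg (fun f => toMap f x) (trans_comp_trans hs (n := n) (Or.inr hkm))⟩,
      fun d hne hd a ha => Thread.isLUB_of_coord fun m => by
        have h := (toMap (trans H n m)).scottContinuous hne hd ha
        exact (congrArg (IsLUB · _) (Set.image_image _ _ _)).mpr h⟩

theorem incl_comp_proj (hs : StrictOnHoms H) (n m : ℕ) :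
    incl hs n ≫ proj hs m = trans H n m := rfl

theorem incl_comp_proj_self (hs : StrictOnHoms H) (n : ℕ) : incl hs n ≫ proj hs n = 𝟙 _ :=
  (incl_comp_proj hs n n).trans (trans_self H n)

theorem trans_comp_incl (hs : StrictOnHoms H) {n m : ℕ} (h : n ≤ m) :
    trans H n m ≫ incl hs m = incl hs n :=
  hom_ext fun x => Subtype.ext <| funext fun k =>
    congrArg (fun f => toMap f x) (trans_comp_trans hs (k := k) (Or.inl h))

theorem proj_comp_trans (hs : StrictOnHoms H) {n m : ℕ} (h : n ≤ m) :
    proj hs m ≫ trans H m n = proj hs n :=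
  hom_ext fun x => Subtype.property x m n h

theorem trans_comp_incl_le (hH : LocallyContinuous H) (hs : StrictOnHoms H) (n m : ℕ) :
    trans H n m ≫ incl hs m ≤ incl hs n :=
  fun x k => trans_comp_trans_le hH hs n m k x

theorem proj_comp_incl_le (hH : LocallyContinuous H) (hs : StrictOnHoms H) (n : ℕ) :
    proj hs n ≫ incl hs n ≤ 𝟙 _ := by
  intro x m
  rcases le_total m n with h | h
  · exact (Subtype.property x n m h).le
  · have h1 := trans_comp_trans_le hH hs m n m (Subtype.val x m)
    rw [trans_self] at h1
    have h2 := Subtype.property x m n h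
    change toMap (trans H n m) (x.1 n) ≤ x.1 m
    rw [← h2]
    exact h1

theorem isChainSup_proj_comp_incl (hH : LocallyContinuous H) (hs : StrictOnHoms H) :
    IsChainSup (fun n => proj hs n ≫ incl hs n) (𝟙 _) := by
  refine ⟨monotone_nat_of_le_succ fun n => ?_, ?_⟩
  · rw [← proj_comp_trans hs n.le_succ, Category.assoc]
    exact comp_mono le_rfl (trans_comp_incl_le hH hs _ _)
  · refine ⟨?_, fun b hb x n => ?_⟩
    · rintro _ ⟨n, rfl⟩
      exact proj_comp_incl_le hH hs n
    · refine le_trans ?_ (hb ⟨n, rfl⟩ x n)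
      exact (Subtype.property x n n le_rfl).ge

/-! ### The fixed point isomorphism -/

/-- The embedding of `Dₙ₊₁`, with its domain written as `H(Dₙ, Dₙ)`. -/
noncomputable def inclSucc (hs : StrictOnHoms H) (n : ℕ) :
    H.obj (op (approx H n), approx H n) ⟶ bilimit hs := incl hs (n + 1)

/-- The projection to `Dₙ₊₁`, with its codomain written as `H(Dₙ, Dₙ)`. -/
def projSucc (hs : StrictOnHoms H) (n : ℕ) :
    bilimit hs ⟶ H.obj (op (approx H n), approx H n) := proj hs (n + 1)

theorem inclSucc_comp_projSucc (hs : StrictOnHoms H) (n : ℕ) :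
    inclSucc hs n ≫ projSucc hs n = 𝟙 _ := incl_comp_proj_self hs (n + 1)

theorem act_comp_inclSucc_le (hH : LocallyContinuous H) (hs : StrictOnHoms H) (n : ℕ) :
    act H (trans H n (n + 1)) (trans H (n + 1) n) ≫ inclSucc hs n ≤ inclSucc hs (n + 1) := by
  have h := trans_comp_incl_le hH hs (n + 2) (n + 1)
  rwa [trans_succ_succ] at h

theorem projSucc_comp_act_le (hH : LocallyContinuous H) (hs : StrictOnHoms H) (n : ℕ) :
    projSucc hs n ≫ act H (trans H (n + 1) n) (trans H n (n + 1)) ≤ projSucc hs (n + 1) := by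
  have h := comp_mono (proj_comp_incl_le hH hs (n + 1)) (le_refl (proj hs (n + 2)))
  rw [Category.assoc, incl_comp_proj, trans_succ_succ] at h
  exact h

theorem exists_isChainSup_act_inclSucc (hH : LocallyContinuous H) (hs : StrictOnHoms H) :
    ∃ φ : H.obj (op (bilimit hs), bilimit hs) ⟶ bilimit hs,
      IsChainSup (fun n => act H (incl hs n) (proj hs n) ≫ inclSucc hs n) φ := by
  refine IsChainSup.exists_of_monotone (monotone_nat_of_le_succ fun n => ?_)
  rw [← trans_comp_incl hs n.le_succ, ← proj_comp_trans hs n.le_succ, ← act_comp, Category.assoc]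
  exact comp_mono le_rfl (act_comp_inclSucc_le hH hs n)

theorem exists_isChainSup_projSucc_act (hH : LocallyContinuous H) (hs : StrictOnHoms H) :
    ∃ φ : bilimit hs ⟶ H.obj (op (bilimit hs), bilimit hs),
      IsChainSup (fun n => projSucc hs n ≫ act H (proj hs n) (incl hs n)) φ := by
  refine IsChainSup.exists_of_monotone (monotone_nat_of_le_succ fun n => ?_)
  rw [← trans_comp_incl hs n.le_succ, ← proj_comp_trans hs n.le_succ, ← act_comp,
    ← Category.assoc]
  exact comp_mono (projSucc_comp_act_le hH hs n) le_rfl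

/-- The iterates of `δ ↦ φ ∘ H(δ, δ) ∘ φ⁻¹` from the least endomorphism. -/
noncomputable def unfold {D : Dcpo.{u}} (φ : H.obj (op D, D) ≅ D) : ℕ → (D ⟶ D)
  | 0 => leastHom D D
  | n + 1 => φ.inv ≫ act H (unfold φ n) (unfold φ n) ≫ φ.hom

/-- A fixed point of the bifunctor is a minimal invariant if the identity is the supremum of its
finite unfoldings. -/
def IsMinimalInvariant {D : Dcpo.{u}} (φ : H.obj (op D, D) ≅ D) : Prop :=
  IsChainSup (unfold φ) (𝟙 D)

/-- The bilimit is a fixed point: `φ = ⨆ₙ ιₙ₊₁ ∘ H(ιₙ, πₙ)` has the inverse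
`⨆ₙ H(πₙ, ιₙ) ∘ πₙ₊₁`, since the composites reduce to `H(ιₙ ∘ πₙ, ιₙ ∘ πₙ)` and `ιₙ₊₁ ∘ πₙ₊₁`.
It is a minimal invariant because its unfoldings lie between `ιₙ ∘ πₙ` and the identity. -/
theorem exists_minimalInvariant_bilimit (hH : LocallyContinuous H) (hs : StrictOnHoms H) :
    ∃ φ : H.obj (op (bilimit hs), bilimit hs) ≅ bilimit hs, IsMinimalInvariant φ := by
  obtain ⟨φ, hφ⟩ := exists_isChainSup_act_inclSucc hH hs
  obtain ⟨χ, hχ⟩ := exists_isChainSup_projSucc_act hH hs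
  have hid := isChainSup_proj_comp_incl hH hs
  have h1 : φ ≫ χ = 𝟙 _ := by
    refine (isChainSup_comp hφ hχ).unique ?_
    have h := hH.isChainSup_act hid hid
    rw [act_id] at h
    convert h using 2 with n
    rw [Category.assoc, ← Category.assoc (inclSucc hs n), inclSucc_comp_projSucc,
      Category.id_comp, act_comp]
  have h2 : χ ≫ φ = 𝟙 _ := by
    refine (isChainSup_comp hχ hφ).unique ?_
    convert hid.succ using 2 with n
    rw [Category.assoc, ← Category.assoc (act H _ _), act_comp, incl_comp_proj_self, act_id,
      Category.id_comp]
    rfl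
  refine ⟨⟨φ, χ, h1, h2⟩, ?_⟩
  set Φ : H.obj (op (bilimit hs), bilimit hs) ≅ bilimit hs := ⟨φ, χ, h1, h2⟩ with hΦ
  have hle : ∀ n, unfold Φ n ≤ 𝟙 _ := by
    intro n
    induction n with
    | zero => exact leastHom_le _
    | succ n ih =>
      refine (comp_mono le_rfl (comp_mono (hH.act_mono ih ih) le_rfl)).trans_eq ?_
      rw [act_id, Category.id_comp, Iso.inv_hom_id]
  have hge : ∀ n, proj hs n ≫ incl hs n ≤ unfold Φ n := by
    intro n
    induction n with
    | zero =>
      -- The one-point domain embeds as the least element.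
      have h : incl hs 0 ≤ leastHom _ _ := fun _ _ => least_le _
      exact comp_mono le_rfl h
    | succ n ih =>
      refine le_trans (Eq.le ?_)
        (comp_mono (hχ.le n) (comp_mono (hH.act_mono ih ih) (hφ.le n)))
      rw [Category.assoc, ← Category.assoc (act H _ _) (act H _ _) (inclSucc hs n), act_comp,
        ← Category.assoc (act H _ _), act_comp, ← Category.assoc (incl hs n) (proj hs n),
        Category.assoc (proj hs n), incl_comp_proj_self, Category.comp_id,
        Category.id_comp, incl_comp_proj_self, act_id, Category.id_comp]
      rfl
  refine ⟨monotone_nat_of_le_succ fun n => ?_, ?_, fun b hb => ?_⟩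
  · induction n with
    | zero => exact leastHom_le _
    | succ n ih => exact comp_mono le_rfl (comp_mono (hH.act_mono ih ih) le_rfl)
  · rintro _ ⟨n, rfl⟩
    exact hle n
  · exact hid.le_of_forall fun n => (hge n).trans (hb ⟨n, rfl⟩)

/-! ### Initiality of minimal invariants -/

section Initial

variable {D E : Dcpo.{u}} {φ : H.obj (op D, D) ≅ D} {ψ : H.obj (op E, E) ≅ E}

/-- The iterates of `(e, p) ↦ (ψ ∘ H(p, e) ∘ φ⁻¹, φ ∘ H(e, p) ∘ ψ⁻¹)` from the least pair. -/
noncomputable def approxPair (φ : H.obj (op D, D) ≅ D) (ψ : H.obj (op E, E) ≅ E) :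
    ℕ → (D ⟶ E) × (E ⟶ D)
  | 0 => (leastHom D E, leastHom E D)
  | n + 1 => (φ.inv ≫ act H (approxPair φ ψ n).2 (approxPair φ ψ n).1 ≫ ψ.hom,
      ψ.inv ≫ act H (approxPair φ ψ n).1 (approxPair φ ψ n).2 ≫ φ.hom)

/-- A morphism that is part of a compatible pair is strict, because `H` only produces strict
morphisms. -/
theorem isStrict_of_hom_comp_eq (hs : StrictOnHoms H) {e : D ⟶ E} {p : E ⟶ D}
    (he : φ.hom ≫ e = act H p e ≫ ψ.hom) : IsStrict e := by
  have : e = φ.inv ≫ act H p e ≫ ψ.hom := (Iso.eq_inv_comp φ).2 he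
  rw [this]
  exact (isStrict_of_iso_hom φ.symm).comp ((hs _ _ _ _ p e).comp (isStrict_of_iso_hom ψ))

/-- A pair compatible with the fixed points is determined on the finite unfoldings. -/
theorem unfold_comp_eq_approxPair (hs : StrictOnHoms H) {e : D ⟶ E} {p : E ⟶ D}
    (he : φ.hom ≫ e = act H p e ≫ ψ.hom) (hp : ψ.hom ≫ p = act H e p ≫ φ.hom) (n : ℕ) :
    unfold φ n ≫ e = (approxPair φ ψ n).1 ∧ p ≫ unfold φ n = (approxPair φ ψ n).2 := by
  induction n with
  | zero => exact ⟨(isStrict_of_hom_comp_eq hs he).leastHom_comp, rfl⟩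
  | succ n ih =>
    have hp' : p ≫ φ.inv = ψ.inv ≫ act H e p := by
      rw [Iso.comp_inv_eq, Category.assoc, Iso.eq_inv_comp, hp]
    refine ⟨?_, ?_⟩
    · simp only [unfold, approxPair, Category.assoc]
      rw [he, ← Category.assoc (act H _ _), act_comp, ih.1, ih.2]
    · simp only [unfold, approxPair]
      rw [← Category.assoc, hp', Category.assoc, ← Category.assoc (act H _ _), act_comp, ih.1,
        ih.2]

theorem monotone_approxPair (hH : LocallyContinuous H) : Monotone (approxPair φ ψ) := by
  refine monotone_nat_of_le_succ fun n => ?_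
  induction n with
  | zero => exact ⟨leastHom_le _, leastHom_le _⟩
  | succ n ih =>
    exact ⟨comp_mono le_rfl (comp_mono (hH.act_mono ih.2 ih.1) le_rfl),
      comp_mono le_rfl (comp_mono (hH.act_mono ih.1 ih.2) le_rfl)⟩

theorem approxPair_comp (n : ℕ) :
    (approxPair φ ψ n).1 ≫ (approxPair φ ψ n).2 = unfold φ n := by
  induction n with
  | zero => rfl
  | succ n ih =>
    simp only [unfold, approxPair, Category.assoc, Iso.hom_inv_id_assoc]
    rw [← Category.assoc (act H _ _), act_comp, ih]

/-- The contraction property is preserved along the iteration, as `H(f, f) ≤ id` for `f ≤ id`. -/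
theorem approxPair_comp_le (hH : LocallyContinuous H) (n : ℕ) :
    (approxPair φ ψ n).2 ≫ (approxPair φ ψ n).1 ≤ 𝟙 E := by
  induction n with
  | zero => exact leastHom_le _
  | succ n ih =>
    simp only [approxPair, Category.assoc, Iso.hom_inv_id_assoc]
    rw [← Category.assoc (act H _ _), act_comp]
    refine (comp_mono le_rfl (comp_mono (hH.act_mono ih ih) le_rfl)).trans_eq ?_
    rw [act_id, Category.id_comp, Iso.inv_hom_id]

/-- A minimal invariant embeds into every fixed point of the bifunctor, and the embedding and its
projection are the only pair of morphisms compatible with the fixed points. -/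
theorem IsMinimalInvariant.exists_unique_pair (hφ : IsMinimalInvariant φ)
    (hH : LocallyContinuous H) (hs : StrictOnHoms H) (ψ : H.obj (op E, E) ≅ E) :
    ∃ (e : D ⟶ E) (p : E ⟶ D), IsEPPair e p ∧
      (φ.hom ≫ e = act H p e ≫ ψ.hom ∧ ψ.hom ≫ p = act H e p ≫ φ.hom) ∧
      ∀ (e' : D ⟶ E) (p' : E ⟶ D), φ.hom ≫ e' = act H p' e' ≫ ψ.hom ∧
        ψ.hom ≫ p' = act H e' p' ≫ φ.hom → e' = e ∧ p' = p := by
  obtain ⟨⟨e, p⟩, hep⟩ := IsChainSup.exists_of_monotone (monotone_approxPair hH (φ := φ) (ψ := ψ))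
  have he : IsChainSup (fun n => (approxPair φ ψ n).1) e := hep.map ScottContinuous.fst
  have hp : IsChainSup (fun n => (approxPair φ ψ n).2) p := hep.map ScottContinuous.snd
  refine ⟨e, p, ⟨?_, ?_⟩, ⟨?_, ?_⟩, fun e' p' h => ⟨?_, ?_⟩⟩
  · have := isChainSup_comp he hp
    simp only [approxPair_comp] at this
    exact this.unique hφ
  · exact (isChainSup_comp hp he).le_of_forall (approxPair_comp_le hH)
  · rw [← Iso.eq_inv_comp]
    exact he.succ.unique
      (isChainSup_comp (.const _) (isChainSup_comp (hH.isChainSup_act hp he) (.const _)))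
  · rw [← Iso.eq_inv_comp]
    exact hp.succ.unique
      (isChainSup_comp (.const _) (isChainSup_comp (hH.isChainSup_act he hp) (.const _)))
  · have := isChainSup_comp hφ (.const e')
    simp only [(unfold_comp_eq_approxPair hs h.1 h.2 _).1] at this
    rw [Category.id_comp] at this
    exact this.unique he
  · have := isChainSup_comp (.const p') hφ
    simp only [(unfold_comp_eq_approxPair hs h.1 h.2 _).2] at this
    rw [Category.comp_id] at this
    exact this.unique hp

end Initial

/-! ### Scott domains among the iterates and their bilimit -/

section Bilimit

variable {H : Dcpo.{u}ᵒᵖ × Dcpo.{u} ⥤ Dcpo.{u}}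

theorem isScott_approx_zero : (approx H 0).IsScott where
  toPointedDcpo := (approx H 0).dcpo
  directedOn_compacts _ _ hx _ _ := ⟨_, hx, le_rfl, le_rfl⟩
  isLUB_compacts _ := ⟨fun _ hk => hk.2, fun _ _ => le_rfl⟩
  bounded_complete _ _ := ⟨PUnit.unit, fun _ _ => le_rfl, fun _ _ => le_rfl⟩

theorem isScott_approx (hS : ∀ X : Dcpo.{u}, X.IsScott → (H.obj (op X, X)).IsScott) (n : ℕ) :
    (approx H n).IsScott := by
  induction n with
  | zero => exact isScott_approx_zero
  | succ n ih => exact hS _ ih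

theorem countablyBased_approx (hS : ∀ X : Dcpo.{u}, X.IsScott → (H.obj (op X, X)).IsScott)
    (hC : ∀ X : Dcpo.{u}, X.IsScott → X.CountablyBased → (H.obj (op X, X)).CountablyBased)
    (n : ℕ) : (approx H n).CountablyBased := by
  induction n with
  | zero => exact Set.Countable.mono (Set.subset_univ _) (Set.countable_univ (α := PUnit))
  | succ n ih => exact hC _ (isScott_approx hS n) ih

theorem isChainSup_proj_comp_incl_apply (hH : LocallyContinuous H) (hs : StrictOnHoms H)
    (x : (bilimit hs).carrier) :
    IsChainSup (fun n => toMap (incl hs n) (toMap (proj hs n) x)) x :=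
  (isChainSup_proj_comp_incl hH hs).map (ScottMap.scottContinuous_apply
    (α := (bilimit hs).carrier) (β := (bilimit hs).carrier) x)

theorem isScott_bilimit (hH : LocallyContinuous H) (hs : StrictOnHoms H)
    (hS : ∀ X : Dcpo.{u}, X.IsScott → (H.obj (op X, X)).IsScott) : (bilimit hs).IsScott :=
  IsScottDomain.of_isChainSup (ι := fun n => toMap (incl hs n)) (π := fun n => toMap (proj hs n))
    (fun n x => congrArg (fun f => toMap f x) (incl_comp_proj_self hs n))
    (isChainSup_proj_comp_incl_apply hH hs) (isScott_approx hS)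

theorem countablyBased_bilimit (hH : LocallyContinuous H) (hs : StrictOnHoms H)
    (hS : ∀ X : Dcpo.{u}, X.IsScott → (H.obj (op X, X)).IsScott)
    (hC : ∀ X : Dcpo.{u}, X.IsScott → X.CountablyBased → (H.obj (op X, X)).CountablyBased) :
    (bilimit hs).CountablyBased :=
  HasCountableBasis.of_isChainSup (ι := fun n => toMap (incl hs n))
    (π := fun n => toMap (proj hs n))
    (fun n x => congrArg (fun f => toMap f x) (incl_comp_proj_self hs n))
    (isChainSup_proj_comp_incl_apply hH hs) (isScott_approx hS) (countablyBased_approx hS hC)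

end Bilimit

/-! ### The bifunctors of the domain equation -/

variable (L : Type)

theorem locallyContinuous_G : LocallyContinuous (G.{u} L) := fun X X' Y Y' =>
  ((ScottContinuous.fst.comp (ScottMap.scottContinuous_powMap L)).prodMk
    (((ScottContinuous.snd.prodMk (ScottContinuous.snd.comp
      (ScottMap.scottContinuous_powMap L))).comp ScottMap.scottContinuous_prodMap).comp
        ScottMap.scottContinuous_liftMap)).comp
    (f := fun p : ScottMap X'.carrier X.carrier × ScottMap Y.carrier Y'.carrier =>
      (p.1.powMap L, (p.2.prodMap (p.2.powMap L)).liftMap)) ScottMap.scottContinuous_fnMap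

theorem locallyContinuous_rhs : LocallyContinuous (rhs.{u} L) := fun X X' Y Y' =>
  (ScottContinuous.fst.prodMk (locallyContinuous_G L X X' Y Y')).comp
    (ScottMap.scottContinuous_fnMap (γ := X'.carrier) (α := X.carrier)
      (β := ((G L).obj (op X, Y)).carrier) (δ := ((G L).obj (op X', Y')).carrier))

/-- Strictness comes from the lifting: the least element of `[X → [F X → (Y × F Y)_⊥]]` is
constantly `⊥`, and `(g × F g)_⊥` preserves `⊥`. -/
theorem strictOnHoms_rhs : StrictOnHoms (rhs.{u} L) := by
  intro X X' Y Y' f g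
  let b : ∀ X Y : Dcpo.{u}, ((rhs L).obj (op X, Y)).carrier := fun X Y =>
    ScottMap.const X.carrier (ScottMap.const (L → X.carrier)
      (⊥ : WithBot (Y.carrier × (L → Y.carrier))))
  have hb : ∀ X Y : Dcpo.{u}, ((rhs L).obj (op X, Y)).least = b X Y := fun X Y =>
    le_antisymm (least_le _) fun x s =>
      bot_le (α := WithBot (Y.carrier × (L → Y.carrier)))
  rw [IsStrict, hb, hb]
  rfl

variable {L}

theorem isScott_GS {S X : Dcpo.{u}} (hS : S.IsScott) (hX : X.IsScott) :
    ((GS S).T X).IsScott :=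
  IsScottDomain.scottMap hS (IsScottDomain.prod hX hS).withBot

theorem countablyBased_GS {S X : Dcpo.{u}} (hS : S.IsScott) (hX : X.IsScott)
    (cS : S.CountablyBased) (cX : X.CountablyBased) : ((GS S).T X).CountablyBased :=
  HasCountableBasis.scottMap hS (IsScottDomain.prod hX hS).withBot cS
    (HasCountableBasis.withBot (IsScottDomain.prod hX hS) (HasCountableBasis.prod hX hS cX cS))

theorem isScott_G {X Y : Dcpo.{u}} (hX : X.IsScott) (hY : Y.IsScott) :
    ((G L).obj (op X, Y)).IsScott :=
  IsScottDomain.scottMap (IsScottDomain.pi L hX)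
    (IsScottDomain.prod hY (IsScottDomain.pi L hY)).withBot

theorem countablyBased_G [Countable L] {X Y : Dcpo.{u}} (hX : X.IsScott) (hY : Y.IsScott)
    (cX : X.CountablyBased) (cY : Y.CountablyBased) : ((G L).obj (op X, Y)).CountablyBased :=
  have hY' := IsScottDomain.prod hY (IsScottDomain.pi L hY)
  HasCountableBasis.scottMap (IsScottDomain.pi L hX) hY'.withBot (HasCountableBasis.pi L hX cX)
    (HasCountableBasis.withBot hY'
      (HasCountableBasis.prod hY (IsScottDomain.pi L hY) cY (HasCountableBasis.pi L hY cY)))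

theorem isScott_rhs {X : Dcpo.{u}} (hX : X.IsScott) : ((rhs L).obj (op X, X)).IsScott :=
  IsScottDomain.scottMap hX (isScott_G hX hX)

theorem countablyBased_rhs [Countable L] {X : Dcpo.{u}} (hX : X.IsScott)
    (cX : X.CountablyBased) : ((rhs L).obj (op X, X)).CountablyBased :=
  HasCountableBasis.scottMap hX (isScott_G hX hX) cX (countablyBased_G hX hX cX cX)

end Dcpo

end StateDomain

theorem mainTheorem3 (L : Type) [Denumerable L] :
    -- `G` is a locally continuous bifunctor which restricts to Scott domains
    Dcpo.LocallyContinuous (Dcpo.G.{u} L) ∧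
    (∀ X Y : Dcpo.{u}, X.IsScott → Y.IsScott →
      ((Dcpo.G L).obj (op X, Y)).IsScott ∧
      (X.CountablyBased → Y.CountablyBased → ((Dcpo.G L).obj (op X, Y)).CountablyBased)) ∧
    -- for any store domain the partiality and state monad restricts to Scott domains
    (∀ S X : Dcpo.{u}, S.IsScott → X.IsScott →
      ((Dcpo.GS S).T X).IsScott ∧
      (S.CountablyBased → X.CountablyBased → ((Dcpo.GS S).T X).CountablyBased)) ∧
    -- there is a Scott domain `D ≅ [D → GS_D D]`, which is the initial solution
    ∃ D : Dcpo.{u}, D.IsScott ∧ D.CountablyBased ∧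
      ∃ φ : Dcpo.fn D ((Dcpo.GS ((Dcpo.store L).obj D)).T D) ≅ D,
        Dcpo.IsInitialSolution L D φ := by
  have hH := Dcpo.locallyContinuous_rhs.{u} L
  have hs := Dcpo.strictOnHoms_rhs.{u} L
  obtain ⟨φ, hφ⟩ := Dcpo.exists_minimalInvariant_bilimit hH hs
  exact ⟨Dcpo.locallyContinuous_G L,
    fun X Y hX hY => ⟨Dcpo.isScott_G hX hY, Dcpo.countablyBased_G hX hY⟩,
    fun S X hS hX => ⟨Dcpo.isScott_GS hS hX, Dcpo.countablyBased_GS hS hX⟩,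
    Dcpo.bilimit hs, Dcpo.isScott_bilimit hH hs fun _ => Dcpo.isScott_rhs,
    Dcpo.countablyBased_bilimit hH hs (fun _ => Dcpo.isScott_rhs)
      fun _ => Dcpo.countablyBased_rhs,
    φ, fun _ ψ _ => hφ.exists_unique_pair hH hs ψ⟩
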